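/- Let $A$ be an infinite Boolean algebra. Let $\mathrm{sub}(A)$ be the number (cardinality of the set) of subalgebras of $A$ and $\mathrm{aut}(A)$ the number of automorphisms of $A$. An ideal $I$ of $A$ is called dense if every nonzero element of $A$ has a nonzero element of $I$ below it; $I=A$ is allowed as an ideal. For ideals $I,J$ of $A$, a homomorphism from $I$ to $J$ is a map preserving $0$, $\cup$ and $\cap$. Consider partial functions $f$ from $A$ to $A$ such that $f(x)=0\Leftrightarrow x=0$ for all $x\in\mathrm{Dom}(f)$. Among these, let - $\mathrm{Aut}_3(A)$ be the set of those $f$ that are homomorphisms from $I$ onto $I$ for some dense ideal $I$ of $A$; - $\mathrm{Aut}_4(A)$ be the set of those $f$ that are homomorphisms from $I$ onto $I$ for some ideal $I$ of $A$; - $\mathrm{Aut}_5(A)$ be the set of those $f$ that are homomorphisms from $I$ onto $J$ for some dense ideals $I,J$ of $A$; - $\mathrm{Aut}_6(A)$ be the set of those $f$ that are homomorphisms from $I$ onto $J$ for some ideals $I,J$ of $A$; where in each case $\mathrm{Dom}(f)=I$. Put $\mathrm{aut}_e(A)=|\mathrm{Aut}_e(A)|$. Then $$\mathrm{aut}(A)^{\aleph_0}\le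 \mathrm{sub}(A),\qquad \mathrm{aut}_e(A)^{\aleph_0}\le \mathrm{sub}(A)\ \text{ for } e=3,4,5,6,\qquad 2^{\aleph_0}\le \mathrm{sub}(A).$$ -/

import Mathlib

open Cardinal

namespace BAlg

universe u

variable (A : Type u) [BooleanAlgebra A]

/-- `Sub(A)`, the set of subalgebras of `A`, has cardinality `sub(A)`. -/
def sub : Cardinal.{u} := #(BooleanSubalgebra A)

/-- The set `Aut(A)` of automorphisms of `A`: the bijective Boolean endomorphisms
(a bounded lattice homomorphism between Boolean algebras preserves complements). -/
def Aut : Set (BoundedLatticeHom A A) := {f | Function.Bijective f}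

/-- `aut(A)`, the number of automorphisms of `A`. -/
def aut : Cardinal.{u} := #(Aut A)

variable {A}

/-- An ideal is dense if every nonzero element of `A` has a nonzero element of the ideal
below it. -/
def IsDenseIdeal (I : Order.Ideal A) : Prop :=
  ∀ a : A, a ≠ ⊥ → ∃ x ∈ I, x ≠ ⊥ ∧ x ≤ a

/-- The partial function `f` from `A` to `A` is a homomorphism from the ideal `I` onto the
ideal `J`: its domain is exactly `I`, its range is exactly `J`, and it preserves `0`, unions and
intersections. -/
structure IsHomOnto (f : A →. A) (I J : Order.Ideal A) : Prop where
  dom_eq : f.Dom = (I : Set A)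
  ran_eq : f.ran = (J : Set A)
  map_bot : ⊥ ∈ f ⊥
  map_sup : ∀ x y u v : A, u ∈ f x → v ∈ f y → u ⊔ v ∈ f (x ⊔ y)
  map_inf : ∀ x y u v : A, u ∈ f x → v ∈ f y → u ⊓ v ∈ f (x ⊓ y)

variable (A)

/-- `End₃(A)`: onto endomorphisms of some dense ideal. -/
def End3 : Set (A →. A) := {f | ∃ I : Order.Ideal A, IsDenseIdeal I ∧ IsHomOnto f I I}

/-- `End₄(A)`: onto endomorphisms of some ideal. -/
def End4 : Set (A →. A) := {f | ∃ I : Order.Ideal A, IsHomOnto f I I}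

/-- `End₅(A)`: homomorphisms from some dense ideal onto some dense ideal. -/
def End5 : Set (A →. A) :=
  {f | ∃ I J : Order.Ideal A, IsDenseIdeal I ∧ IsDenseIdeal J ∧ IsHomOnto f I J}

/-- `End₆(A)`: homomorphisms from some ideal onto some ideal. -/
def End6 : Set (A →. A) := {f | ∃ I J : Order.Ideal A, IsHomOnto f I J}

/-- The partial functions `f` with `f(x) = 0 ↔ x = 0` for all `x` in the domain of `f`. -/
def TrivialKernel : Set (A →. A) := {f | ∀ x ∈ f.Dom, (⊥ ∈ f x ↔ x = ⊥)}

/-- `Aut₃(A)`. -/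
def Aut3 : Set (A →. A) := End3 A ∩ TrivialKernel A

/-- `Aut₄(A)`. -/
def Aut4 : Set (A →. A) := End4 A ∩ TrivialKernel A

/-- `Aut₅(A)`. -/
def Aut5 : Set (A →. A) := End5 A ∩ TrivialKernel A

/-- `Aut₆(A)`. -/
def Aut6 : Set (A →. A) := End6 A ∩ TrivialKernel A

/-- `aut₃(A)`. -/
def aut3 : Cardinal.{u} := #(Aut3 A)

/-- `aut₄(A)`. -/
def aut4 : Cardinal.{u} := #(Aut4 A)

/-- `aut₅(A)`. -/
def aut5 : Cardinal.{u} := #(Aut5 A)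

/-- `aut₆(A)`. -/
def aut6 : Cardinal.{u} := #(Aut6 A)

end BAlg

universe u v
open Cardinal Set

/-! All the sets of maps in question embed in `BAlg.Aut6 A`, so it suffices to bound `aut6 ^ ℵ₀` by
`sub`. Let i be the number of ideals of `A`. Two facts carry the proof: i is at most `sub`
(`mk_ideal_le_sub`), and i ^ ℵ₀ = i (`mk_ideal_power_aleph0`); together with ℵ₀ ≤ i they also give
the bound by 2 ^ ℵ₀.

For i ^ ℵ₀ = i, pass to the Stone space X, whose closed sets correspond to ideals. If their number κ
satisfies κ < κ ^ ℵ₀, let μ be least with κ < μ ^ ℵ₀. Then no cardinal a ^ b with b infinite lies in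
the interval [μ, κ], so any bound by κ on such a power improves to a bound below μ. If infinitely
many points had only neighbourhoods with at least ε closed traces, for every ε < μ, then disjoint
clopen sets with large counts would yield more than κ closed sets. So for some ν < μ all but
finitely many points have a neighbourhood with at most ν traces. The set Z of these points has a
network of size below μ (`networkLT_of_locally_count_le`), and an induction on network size
(`exists_countBound`) bounds the traces on Z by a cardinal below μ. Then κ < μ ≤ κ, which is absurd.

For the automorphisms, fix a maximal disjoint set C of elements homogeneous in three invariants:
number of automorphisms, cellularity and size. An isomorphism between ideals with domain I is
determined by its restrictions to a maximal disjoint set E of elements of I, each below a member of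
C. The images of the members of E can be chosen in at most i ways, and the isomorphism on each e in
E in at most `autCard e` ways. Homogeneity leaves room to realize countably many such families E
simultaneously by disjoint elements (`exists_assignment`), each with at least `autCard e` relative
subalgebras; gluing them bounds the product of all the `autCard e` by `sub` (`prod_autCard_le_sub`).
-/

theorem exists_wf_rec {ι : Type u} {α : Type v} [LinearOrder ι] [WellFoundedLT ι] [Nonempty α]
    (R : ι → (ι → α) → α → Prop)
    (hc : ∀ ξ (h h' : ι → α) a, (∀ η < ξ, h η = h' η) → R ξ h a → R ξ h' a)
    (hex : ∀ ξ h, (∀ η < ξ, R η h (h η)) → ∃ a, R ξ h a) : ∃ f : ι → α, ∀ ξ, R ξ f (f ξ) := by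
  classical
  have a0 : α := Classical.arbitrary α
  let F : (x : ι) → ((y : ι) → y < x → α) → α := fun ξ rec =>
    Classical.epsilon (R ξ (fun η => if h : η < ξ then rec η h else a0))
  let f : ι → α := fun ξ => (wellFounded_lt (α := ι)).fix F ξ
  have hf : ∀ ξ, f ξ = Classical.epsilon (R ξ (fun η => if η < ξ then f η else a0)) := by
    intro ξ
    have := (wellFounded_lt (α := ι)).fix_eq F ξ
    simpa [F, f] using this
  refine ⟨f, fun ξ => ?_⟩
  induction ξ using WellFoundedLT.induction with
  | ind ξ ih =>
    obtain ⟨a, ha⟩ := hex ξ f ih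
    have h1 : R ξ (fun η => if η < ξ then f η else a0) a :=
      hc ξ _ _ a (fun η hη => by simp [hη]) ha
    have h2 := Classical.epsilon_spec (p := R ξ (fun η => if η < ξ then f η else a0)) ⟨a, h1⟩
    rw [← hf] at h2
    exact hc ξ _ _ _ (fun η hη => by simp [hη]) h2

/-! ### Powers, products and cofinality of cardinals -/

namespace Cardinal

theorem exists_cofinal_toType (W : Cardinal.{u}) :
    ∃ C : Set W.ord.ToType, IsCofinal C ∧ #C = W.ord.cof := by
  obtain ⟨C, h1, h2⟩ := Order.exists_cof_eq W.ord.ToType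
  exact ⟨C, h1, h2.trans (Ordinal.cof_toType _)⟩

theorem exists_forall_lt_of_mk_lt_cof {W : Cardinal.{u}} {T : Type u} (h : #T < W.ord.cof)
    (g : T → W.ord.ToType) : ∃ b, ∀ x, g x < b := by
  have : ¬ IsCofinal (range g) := fun hc => by
    have := (Order.cof_le hc).trans mk_range_le
    rw [Ordinal.cof_toType] at this
    exact absurd h this.not_gt
  obtain ⟨b, hb⟩ := not_isCofinal_iff.1 this
  exact ⟨b, fun x => hb _ ⟨x, rfl⟩⟩

theorem mk_Iio_toType_lt {W : Cardinal.{u}} (i : W.ord.ToType) : #(Iio i) < W := by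
  have := mk_Iio_lt i (by rw [mk_ord_toType, Ordinal.type_toType])
  rwa [mk_ord_toType] at this

theorem mk_Iic_toType_lt {W : Cardinal.{u}} (hW : ℵ₀ ≤ W) (i : W.ord.ToType) :
    #(Iic i) < W := by
  rw [← Iio_union_right]
  refine (mk_union_le _ _).trans_lt (add_lt_of_lt hW (mk_Iio_toType_lt i) ?_)
  rw [mk_singleton]; exact one_lt_aleph0.trans_le hW

theorem power_le_of_lt_cof {W t : Cardinal.{u}} (hW : ℵ₀ ≤ W) (ht : t < W.ord.cof)
    (h : ∀ e < W, e ^ t ≤ W) : W ^ t ≤ W := by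
  induction t using Cardinal.inductionOn with
  | _ T =>
  have h1 : #(T → W.ord.ToType) ≤ #(Σ b : W.ord.ToType, T → Iio b) := by
    choose b hb using fun g : T → W.ord.ToType => exists_forall_lt_of_mk_lt_cof ht g
    refine mk_le_of_injective (f := fun g => ⟨b g, fun x => ⟨g x, hb g x⟩⟩) ?_
    intro g g' e
    have h2 : ∀ s s' : (Σ b : W.ord.ToType, T → Iio b), s = s' →
      (fun x => (s.2 x : W.ord.ToType)) = fun x => (s'.2 x : W.ord.ToType) := by
      rintro s s' rfl; rfl
    exact h2 _ _ e
  rw [← power_def, mk_ord_toType] at h1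
  refine h1.trans ?_
  rw [mk_sigma]
  calc _ ≤ sum (fun _ : W.ord.ToType => W) := sum_le_sum _ _ fun b => by
          rw [← power_def]; exact h _ (mk_Iio_toType_lt b)
    _ = W := by rw [sum_const', mk_ord_toType, mul_eq_self hW]

/-- A function g into W is determined by its truncations min(g, c), with c running over a cofinal
set, and each truncation takes its values in a set of size below W. -/
theorem power_le_power_cof {W t : Cardinal.{u}} (hW : ℵ₀ ≤ W)
    (h : ∀ e < W, e ^ t ≤ W) : W ^ t ≤ W ^ W.ord.cof := by
  induction t using Cardinal.inductionOn with
  | _ T =>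
  obtain ⟨C, hC, hC'⟩ := exists_cofinal_toType W
  have h1 : #(T → W.ord.ToType) ≤ #(∀ c : C, T → Iic (c : W.ord.ToType)) := by
    refine mk_le_of_injective (f := fun g c x => ⟨min (g x) c, mem_Iic.2 (min_le_right _ _)⟩) ?_
    intro g g' e
    funext x
    obtain ⟨c, hc, hc'⟩ := hC (max (g x) (g' x))
    have := congrArg Subtype.val (congrFun (congrFun e ⟨c, hc⟩) x)
    simpa [min_eq_left (le_trans (le_max_left _ _) hc'),
      min_eq_left (le_trans (le_max_right _ _) hc')] using this
  rw [← power_def, mk_ord_toType] at h1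
  refine h1.trans ?_
  rw [mk_pi, ← hC']
  refine (prod_le_prod _ (fun _ => W) fun c => ?_).trans (by rw [prod_const'])
  rw [← power_def]
  exact h _ (mk_Iic_toType_lt hW _)

theorem exists_cofinal_family {W : Cardinal.{u}} (hW : ℵ₀ < W) (hcof : ℵ₀ ≤ W.ord.cof) :
    ∃ (C : Type u) (g : C → Cardinal.{u}), #C = W.ord.cof ∧ (∀ c, g c < W) ∧
      (∀ e < W, ∃ c, e ≤ g c) ∧ W ≤ prod g ∧ W ≤ sum g := by
  obtain ⟨C, hC, hC'⟩ := exists_cofinal_toType W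
  have h2W : 2 < W := (natCast_lt_aleph0 (n := 2)).trans hW
  -- The lower bound 2 makes the product at least 2 ^ cof W, hence at least cof W, even if the
  -- initial segments are small.
  let g : C → Cardinal.{u} := fun c => max 2 #(Iic (c : W.ord.ToType))
  have hg : ∀ c, g c < W := fun c => max_lt h2W (mk_Iic_toType_lt hW.le _)
  have hg' : ∀ e < W, ∃ c, e ≤ g c := by
    intro e he
    have h1 : e.ord < Ordinal.type (α := W.ord.ToType) (· < ·) := by
      rw [Ordinal.type_toType]; exact ord_lt_ord.2 he
    obtain ⟨c, hc, hc'⟩ := hC (Ordinal.enum (α := W.ord.ToType) (· < ·) ⟨e.ord, h1⟩)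
    refine ⟨⟨c, hc⟩, le_max_of_le_right ?_⟩
    have h2 : #(Iio (Ordinal.enum (α := W.ord.ToType) (· < ·) ⟨e.ord, h1⟩)) = e := by
      have := Ordinal.typein_enum (α := W.ord.ToType) (· < ·) h1
      have h3 := congrArg Ordinal.card this
      rw [card_ord] at h3
      exact h3
    refine h2.symm.le.trans (mk_le_mk_of_subset fun x hx => ?_)
    exact mem_Iic.2 ((le_of_lt hx).trans hc')
  have key : ∀ P : Cardinal.{u}, W.ord.cof ≤ P → (∀ c, g c ≤ P) → W ≤ P := by
    intro P hcP hle
    by_contra hlt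
    push Not at hlt
    rcases (Order.succ_le_of_lt hlt).lt_or_eq with h3 | h3
    · obtain ⟨c, hc⟩ := hg' _ h3
      exact absurd ((Order.lt_succ _).trans_le (hc.trans (hle c))) (lt_irrefl _)
    -- If W were the successor of P it would be regular, so cof W = W > P.
    · have h4 := (isRegular_succ (hcof.trans hcP)).cof_ord
      have h6 : W.ord.cof = Order.succ P := (congrArg (fun x => x.ord.cof) h3).symm.trans h4
      exact absurd (Order.lt_succ P) (h6 ▸ hcP).not_gt
  refine ⟨C, g, hC', hg, hg', key _ ?_ fun c => ?_, key _ ?_ fun c => le_sum g c⟩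
  · refine (cantor _).le.trans ?_
    rw [← hC', ← prod_const']
    exact prod_le_prod _ _ fun c => le_max_left _ _
  · have : ∀ d, g d ≠ 0 := fun d => (lt_of_lt_of_le two_pos (le_max_left _ _)).ne'
    have h3 : #(g c).out ≤ #(∀ d, (g d).out) := by
      classical
      have : ∀ d, Nonempty (g d).out := fun d => by
        rw [← mk_ne_zero_iff, mk_out]; exact this d
      refine mk_le_of_injective (f := fun x d => if h : d = c then h ▸ x else (this d).some) ?_
      intro x y e
      simpa using congrFun e c
    simpa [mk_pi] using h3
  · rw [← hC', ← mul_one #C, ← sum_const']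
    exact sum_le_sum _ _ fun c => one_le_two.trans (le_max_left _ _)

theorem prod_comp_le_of_injective {ι κ : Type u} (n : κ → Cardinal.{u}) (hn : ∀ b, 1 ≤ n b)
    (f : ι → κ) (hf : Function.Injective f) : prod (fun i => n (f i)) ≤ prod n := by
  classical
  have hne : ∀ d, Nonempty (n d).out := fun d => by
    rw [← mk_ne_zero_iff, mk_out]; exact (zero_lt_one.trans_le (hn d)).ne'
  have : #(∀ i, (n (f i)).out) ≤ #(∀ d, (n d).out) := by
    refine mk_le_of_surjective (f := fun g i => g (f i)) ?_
    intro g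
    refine ⟨fun d => if h : ∃ i, f i = d then h.choose_spec ▸ g h.choose else (hne d).some, ?_⟩
    funext i
    have h : ∃ j, f j = f i := ⟨i, rfl⟩
    have h2 : ∀ j (hj : f j = f i), (hj ▸ g j : (n (f i)).out) = g i := by
      intro j hj
      obtain rfl := hf hj
      rfl
    simp only [h, dif_pos]
    exact h2 _ _
  simpa [mk_pi] using this

/-- Distinct indices are picked greedily so that every member of a cofinal family below W is
dominated cof W times. One copy of the family already has product at least W. -/
theorem power_cof_le_prod {W : Cardinal.{u}} (hW : ℵ₀ < W) (hcof : ℵ₀ ≤ W.ord.cof) {B : Type u}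
    (n : B → Cardinal.{u}) (hn : ∀ b, 1 ≤ n b)
    (h : ∀ e < W, W.ord.cof ≤ #{b | e ≤ n b}) : W ^ W.ord.cof ≤ prod n := by
  obtain ⟨C, g, hC, hgW, hg, hprod, -⟩ := exists_cofinal_family hW hcof
  let ι := W.ord.cof.ord.ToType
  have hι : #ι = W.ord.cof := mk_ord_toType _
  have he : #ι = #(C × ι) := by rw [mk_prod, hι, hC, lift_id, mul_eq_self hcof]
  obtain ⟨e⟩ := Cardinal.eq.1 he
  have hne : Nonempty B := by
    have h0 := h 0 (aleph0_pos.trans hW)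
    have : #{b | 0 ≤ n b} ≠ 0 := (aleph0_pos.trans_le (hcof.trans h0)).ne'
    rw [mk_ne_zero_iff] at this
    exact ⟨this.some.1⟩
  obtain ⟨f, hf⟩ := exists_wf_rec (ι := ι) (α := B)
    (fun ξ h b => g (e ξ).1 ≤ n b ∧ ∀ η < ξ, h η ≠ b) (by
      intro ξ h h' a hh hR
      exact ⟨hR.1, fun η hη => hh η hη ▸ hR.2 η hη⟩) (by
      intro ξ k _
      by_contra hcon
      push Not at hcon
      have h1 := h _ (hgW (e ξ).1)
      have h2 : {b | g (e ξ).1 ≤ n b} ⊆ k '' Iio ξ := by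
        intro b hb
        obtain ⟨η, hη, rfl⟩ := hcon b hb
        exact ⟨η, hη, rfl⟩
      have h3 := (h1.trans (mk_le_mk_of_subset h2)).trans mk_image_le
      exact absurd (mk_Iio_toType_lt ξ) h3.not_gt)
  have hinj : Function.Injective f := by
    intro a b hab
    rcases lt_trichotomy a b with hlt | rfl | hlt
    · exact absurd hab ((hf b).2 a hlt)
    · rfl
    · exact absurd hab.symm ((hf a).2 b hlt)
  refine le_trans ?_ (prod_comp_le_of_injective n hn _ (hinj.comp e.symm.injective))
  calc W ^ W.ord.cof = prod fun _ : ι => W := by rw [prod_const', hι]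
    _ ≤ prod (fun _ : ι => prod g) := prod_le_prod _ _ fun _ => hprod
    _ = #(∀ _ : ι, ∀ c : C, (g c).out) := by simp [mk_pi]
    _ = #(∀ p : C × ι, (g p.1).out) := by
        refine mk_congr ⟨fun k p => k p.2 p.1, fun k i c => k (c, i), fun _ => rfl, fun _ => rfl⟩
    _ = prod fun p : C × ι => g p.1 := by simp [mk_pi]
    _ ≤ _ := prod_le_prod _ _ fun p => by simpa using (hf (e.symm p)).1

/-! ### Power gaps -/

/-- `μ` is an infinite cardinal below which `ℵ₀`-th powers stay, while `κ < μ ^ ℵ₀`. -/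
structure PowerGap (κ μ : Cardinal.{u}) : Prop where
  aleph0_lt : ℵ₀ < μ
  le : μ ≤ κ
  lt_power : κ < μ ^ ℵ₀
  small : ∀ e < μ, e ^ ℵ₀ < μ

theorem exists_powerGap {κ : Cardinal.{u}} (h2 : 2 ^ ℵ₀ ≤ κ) (h : κ < κ ^ ℵ₀) :
    ∃ μ, PowerGap κ μ := by
  have hex : ∃ m : Cardinal.{u}, κ < m ^ ℵ₀ := ⟨κ, h⟩
  let μ := (wellFounded_lt (α := Cardinal.{u})).min {m | κ < m ^ ℵ₀} hex
  have hμ : κ < μ ^ ℵ₀ := (wellFounded_lt (α := Cardinal.{u})).min_mem {m | κ < m ^ ℵ₀} hex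
  have hmin : ∀ m, κ < m ^ ℵ₀ → μ ≤ m := fun m hm =>
    (wellFounded_lt (α := Cardinal.{u})).min_le hm
  have hs : ∀ e < μ, e ^ ℵ₀ ≤ κ := fun e he => by
    by_contra hc
    exact absurd he (hmin e (not_le.1 hc)).not_gt
  refine ⟨μ, ?_, hmin _ h, hμ, ?_⟩
  · by_contra hc
    push Not at hc
    have := power_le_power_right (c := ℵ₀) hc
    rw [power_self_eq le_rfl] at this
    exact absurd hμ (this.trans h2).not_gt
  · intro e he
    by_contra hc
    push Not at hc
    have := power_le_power_right (c := ℵ₀) hc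
    rw [← power_mul, aleph0_mul_aleph0] at this
    exact absurd hμ (this.trans (hs e he)).not_gt

namespace PowerGap

variable {κ μ : Cardinal.{u}}

/-- This is the engine of every contradiction below: a power with infinite exponent is its own ℵ₀-th
power, so if it reached μ it would be at least μ ^ ℵ₀ > κ. -/
theorem power_lt (hg : PowerGap κ μ) {a b : Cardinal.{u}} (hb : ℵ₀ ≤ b) (h : a ^ b ≤ κ) :
    a ^ b < μ := by
  by_contra hc
  push Not at hc
  have := power_le_power_right (c := ℵ₀) hc
  rw [← power_mul, mul_aleph0_eq hb] at this
  exact absurd hg.lt_power (this.trans h).not_gt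

theorem power_lt_of_power_lt (hg : PowerGap κ μ) {a b : Cardinal.{u}} (hb : b ≤ ℵ₀) (h : a < μ) :
    a ^ b < μ := by
  have h1 : (max a 1) ^ ℵ₀ < μ := hg.small _ (max_lt h (one_lt_aleph0.trans hg.aleph0_lt))
  refine lt_of_le_of_lt ?_ h1
  refine (power_le_power_right (le_max_left a 1)).trans (power_le_power_left ?_ hb)
  exact (zero_lt_one.trans_le (le_max_right a 1)).ne'

theorem cof_eq (hg : PowerGap κ μ) : μ.ord.cof = ℵ₀ := by
  have h1 : ℵ₀ ≤ μ.ord.cof :=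
    Ordinal.aleph0_le_cof_iff.2 (Ordinal.one_lt_cof_iff.2 (isSuccLimit_ord hg.aleph0_lt.le))
  refine le_antisymm ?_ h1
  by_contra hc
  push Not at hc
  have := power_le_of_lt_cof hg.aleph0_lt.le hc fun e he => (hg.small e he).le
  exact absurd hg.lt_power (this.trans hg.le).not_gt

theorem exists_seq (hg : PowerGap κ μ) : ∃ s : ℕ → Cardinal.{u}, (∀ n, s n < μ) ∧
    (∀ e < μ, ∃ n, e ≤ s n) ∧
    ∀ k : ℕ → Cardinal.{u}, (∀ n, s n ≤ k n) → κ < prod (fun n : ULift.{u} ℕ => k n.down) := by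
  obtain ⟨C, g, hC, hgW, hgc, -, -⟩ := exists_cofinal_family hg.aleph0_lt hg.cof_eq.ge
  rw [hg.cof_eq] at hC
  have hC2 : #C = #(ULift.{u} ℕ) := by simp [hC]
  obtain ⟨e⟩ := Cardinal.eq.1 hC2
  -- Unpairing repeats each member of the cofinal family infinitely often, which supplies the ℵ₀
  -- large factors that `power_cof_le_prod` asks for.
  let s : ℕ → Cardinal.{u} := fun n => max 1 (g (e.symm ⟨n.unpair.1⟩))
  refine ⟨s, fun n => max_lt (one_lt_aleph0.trans hg.aleph0_lt) (hgW _), ?_, ?_⟩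
  · intro ε hε
    obtain ⟨c, hc⟩ := hgc ε hε
    have h1 : e.symm ⟨(e c).down⟩ = c := e.symm_apply_apply c
    exact ⟨Nat.pair (e c).down 0, by simp [s, h1, hc]⟩
  · intro k hk
    refine hg.lt_power.trans_le ?_
    have := power_cof_le_prod hg.aleph0_lt hg.cof_eq.ge (fun n : ULift.{u} ℕ => k n.down)
      (fun b => (le_max_left _ _).trans (hk b.down)) ?_
    · rwa [hg.cof_eq] at this
    · intro ε hε
      obtain ⟨c, hc⟩ := hgc ε hε
      rw [hg.cof_eq, aleph0_le_mk_iff, Set.infinite_coe_iff]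
      refine Set.infinite_of_injective_forall_mem (f := fun m : ℕ => ULift.up (Nat.pair (e c).down m))
        ?_ ?_
      · intro a b hab
        simpa using hab
      · intro m
        refine le_trans ?_ (hk _)
        have h1 : e.symm ⟨(e c).down⟩ = c := e.symm_apply_apply c
        simp [s, h1, hc]

/-- Since μ has cofinality ℵ₀, failure of uniformity is witnessed by countably many s < c, and their
supremum is still below c. -/
theorem exists_uniform (hg : PowerGap κ μ) {c : Cardinal.{u}} (hc : ℵ₀ < c.ord.cof)
    (P : Cardinal.{u} → Cardinal.{u} → Prop)
    (hP : ∀ s s' e e', s' ≤ s → e ≤ e' → P s e → P s' e')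
    (h : ∀ s < c, ∃ e < μ, P s e) : ∃ e < μ, ∀ s < c, P s e := by
  obtain ⟨s, hs, hs', -⟩ := hg.exists_seq
  by_contra hcon
  push Not at hcon
  choose t ht ht' using fun n => hcon (s n) (hs n)
  have hlt : ⨆ n : ULift.{u} ℕ, t n.down < c :=
    iSup_lt_of_lt_cof_ord (by simpa using hc) fun n => ht _
  obtain ⟨e, he, hPe⟩ := h _ hlt
  obtain ⟨n, hn⟩ := hs' e he
  exact ht' n (hP _ _ _ _ (le_ciSup (f := fun n : ULift.{u} ℕ => t n.down)
    bddAbove_of_small ⟨n⟩) hn hPe)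

/-- W is the least base whose t-th power reaches μ. Minimality keeps t-th powers of smaller
cardinals below W, which forces cof W ≤ t and lets the exponent t be replaced by cof W. -/
theorem exists_least_base (hg : PowerGap κ μ) {ν t : Cardinal.{u}} (hν : ν < μ) (hωt : ℵ₀ < t)
    (ht : 2 ^ t < μ) (h : μ ≤ ν ^ t) : ∃ W ≤ ν, 2 ^ t < W ∧ (∀ e < W, e ^ t < W) ∧
      μ ≤ W ^ W.ord.cof ∧ ℵ₀ < W.ord.cof ∧ W.ord.cof ≤ t := by
  let S : Set Cardinal.{u} := {W | μ ≤ W ^ t}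
  have hS : S.Nonempty := ⟨_, h⟩
  let W := (wellFounded_lt (α := Cardinal.{u})).min S hS
  have hW : μ ≤ W ^ t := (wellFounded_lt (α := Cardinal.{u})).min_mem S hS
  have hmin : ∀ e < W, e ^ t < W := by
    intro e he
    by_contra hc
    push Not at hc
    have h1 := power_le_power_right (c := t) hc
    rw [← power_mul, mul_eq_self hωt.le] at h1
    have : W ≤ e := (wellFounded_lt (α := Cardinal.{u})).min_le (s := S) (hW.trans h1)
    exact absurd he this.not_gt
  have hWle : W ≤ ν := (wellFounded_lt (α := Cardinal.{u})).min_le (s := S) h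
  have hWν : W < μ := hWle.trans_lt hν
  have h2tW : 2 ^ t < W := by
    by_contra hc
    push Not at hc
    have h1 := power_le_power_right (c := t) hc
    rw [← power_mul, mul_eq_self hωt.le] at h1
    exact absurd ht (hW.trans h1).not_gt
  have htW : t < W := (cantor t).trans h2tW
  have hωW : ℵ₀ < W := hωt.trans htW
  have hcof : W.ord.cof ≤ t := by
    by_contra hc
    have := power_le_of_lt_cof hωW.le (not_le.1 hc) fun e he => (hmin e he).le
    exact absurd hWν (hW.trans this).not_gt
  have hpow : μ ≤ W ^ W.ord.cof :=
    hW.trans (power_le_power_cof hωW.le fun e he => (hmin e he).le)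
  have hcof' : ℵ₀ < W.ord.cof := by
    by_contra hc
    exact absurd (hg.power_lt_of_power_lt (not_lt.1 hc) hWν) hpow.not_gt
  exact ⟨W, hWle, h2tW, hmin, hpow, hcof', hcof⟩

/-- A single bound below μ serves all admissible products. The induction on t splits the factors at
a threshold ε < W: fewer than cof W ≤ t of them are large, and the small ones multiply to less than
W. -/
theorem exists_prod_bound (hg : PowerGap κ μ) {ν : Cardinal.{u}} (hν : ν < μ) (t : Cardinal.{u})
    (ht : 2 ^ t < μ) : ∃ e < μ, ∀ (ι : Type u) (n : ι → Cardinal.{u}), #ι ≤ t →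
      (∀ b, 1 ≤ n b) → (∀ b, n b ≤ ν) → prod n ≤ κ → prod n ≤ e := by
  induction t using WellFoundedLT.induction with
  | ind t ih =>
  have hone : 1 < μ := one_lt_aleph0.trans hg.aleph0_lt
  by_cases hsmall : (max ν 1) ^ t < μ
  · refine ⟨_, hsmall, fun ι n hι h1 hn _ => ?_⟩
    refine (prod_le_prod _ (fun _ => max ν 1) fun b => (hn b).trans (le_max_left _ _)).trans ?_
    rw [prod_const']
    exact power_le_power_left (zero_lt_one.trans_le (le_max_right _ _)).ne' hι
  have hωt : ℵ₀ < t := by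
    by_contra hc
    exact hsmall (hg.power_lt_of_power_lt (not_lt.1 hc) (max_lt hν hone))
  push Not at hsmall
  obtain ⟨W, hWν, h2tW, hmin, hpow, hcof', hcof⟩ :=
    hg.exists_least_base (max_lt hν hone) hωt ht hsmall
  replace hWν := hWν.trans_lt (max_lt hν hone)
  have hωW : ℵ₀ < W := (hωt.trans (cantor t)).trans h2tW
  obtain ⟨e, he, hbd⟩ := hg.exists_uniform (c := W.ord.cof) (by rwa [Ordinal.cof_ord_cof])
    (fun s e => ∀ (ι : Type u) (n : ι → Cardinal.{u}), #ι ≤ s →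
      (∀ b, 1 ≤ n b) → (∀ b, n b ≤ ν) → prod n ≤ κ → prod n ≤ e)
    (fun s s' e e' hs he h ι n hι h1 h2 h3 => (h ι n (hι.trans hs) h1 h2 h3).trans he)
    (fun s hs => ih s (hs.trans_le hcof)
      ((power_le_power_left two_ne_zero (hs.le.trans hcof)).trans_lt ht))
  refine ⟨e * W, mul_lt_of_lt hg.aleph0_lt.le he hWν, fun ι n hι h1 hn hprod => ?_⟩
  -- Otherwise the product would be at least W ^ cof W, a power that reaches μ and so cannot be at
  -- most κ.
  have : ∃ ε < W, #{b | ε ≤ n b} < W.ord.cof := by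
    by_contra hcon
    push Not at hcon
    have h3 := power_cof_le_prod hωW hcof'.le n h1 hcon
    exact absurd (hg.power_lt hcof'.le (h3.trans hprod)) hpow.not_gt
  obtain ⟨ε, hε, hcard⟩ := this
  have h0 : prod n = prod (fun i : {b | ε ≤ n b} => n i) *
      prod (fun i : ({b | ε ≤ n b}ᶜ : Set ι) => n i) := by
    have := mk_congr (Equiv.piEquivPiSubtypeProd (fun b => ε ≤ n b) (fun b => (n b).out))
    rw [mk_prod, mk_pi, mk_pi, mk_pi] at this
    simp only [mk_out, lift_id] at this
    exact this
  rw [h0]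
  refine mul_le_mul' ?_ ?_
  · refine hbd _ hcard _ _ le_rfl (fun b => h1 _) (fun b => hn _) ?_
    exact (prod_comp_le_of_injective n h1 _ Subtype.val_injective).trans hprod
  · refine (prod_le_prod _ (fun _ => max ε 1) fun b => ?_).trans ?_
    · exact le_max_of_le_left (not_le.1 (show ¬ ε ≤ n b from b.2)).le
    · rw [prod_const']
      refine (power_le_power_left (zero_lt_one.trans_le (le_max_right _ _)).ne'
        ((mk_subtype_le _).trans hι)).trans ?_
      exact (hmin _ (max_lt hε (one_lt_aleph0.trans hωW))).le

end PowerGap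
end Cardinal

/-! ### Traces of closed sets, networks and discrete sets -/

namespace TraceCount

section Basic

variable {X : Type u} [TopologicalSpace X]

/-- The traces on `Y` of the closed sets. -/
def traces (Y : Set X) : Set (Set X) := {S | ∃ F, IsClosed F ∧ S = F ∩ Y}

/-- The number of relatively closed subsets of `Y`. -/
def count (Y : Set X) : Cardinal.{u} := #(traces Y)

/-- `Y` has a network of at most `κ` sets. -/
def HasNetwork (Y : Set X) (κ : Cardinal.{u}) : Prop :=
  ∃ N : Set (Set X), #N ≤ κ ∧ ∀ y ∈ Y, ∀ O, IsOpen O → y ∈ O → ∃ M ∈ N, y ∈ M ∧ M ⊆ O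

/-- `Y` has a network of fewer than `κ` sets. -/
def NetworkLT (Y : Set X) (κ : Cardinal.{u}) : Prop := ∃ e < κ, HasNetwork Y e

/-- Every point of `D` is isolated in `D`. -/
def Disc (D : Set X) : Prop := ∀ x ∈ D, ∃ O, IsOpen O ∧ O ∩ D = {x}

theorem count_mono {Y Y' : Set X} (h : Y ⊆ Y') : count Y ≤ count Y' := by
  refine mk_le_of_surjective (f := fun S : traces Y' => (⟨S.1 ∩ Y, ?_⟩ : traces Y)) ?_
  · obtain ⟨F, hF, hS⟩ := S.2
    refine ⟨F, hF, ?_⟩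
    rw [hS, inter_assoc, inter_eq_self_of_subset_right h]
  · rintro ⟨S, F, hF, rfl⟩
    refine ⟨⟨F ∩ Y', F, hF, rfl⟩, Subtype.ext ?_⟩
    simp only [inter_assoc, inter_eq_self_of_subset_right h]

theorem one_le_count (Y : Set X) : 1 ≤ count Y := by
  rw [Cardinal.one_le_iff_ne_zero, count, mk_ne_zero_iff]
  exact ⟨⟨∅ ∩ Y, ∅, isClosed_empty, rfl⟩⟩

theorem count_iUnion_le {ι : Type u} (Y : ι → Set X) :
    count (⋃ i, Y i) ≤ prod fun i => count (Y i) := by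
  have h : ∀ S : traces (⋃ i, Y i), ∀ i, S.1 ∩ Y i ∈ traces (Y i) := by
    rintro ⟨S, F, hF, rfl⟩ i
    refine ⟨F, hF, ?_⟩
    rw [inter_assoc, inter_eq_self_of_subset_right (subset_iUnion _ i)]
  have : count (⋃ i, Y i) ≤ #(∀ i, traces (Y i)) := by
    refine mk_le_of_injective (f := fun S i => ⟨S.1 ∩ Y i, h S i⟩) ?_
    rintro S S' e
    have hs : ∀ T : traces (⋃ i, Y i), T.1 = ⋃ i, T.1 ∩ Y i := by
      rintro ⟨T, F, hF, rfl⟩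
      rw [← inter_iUnion, inter_assoc, inter_self]
    refine Subtype.ext ?_
    rw [hs S, hs S']
    exact iUnion_congr fun i => congrArg Subtype.val (congrFun e i)
  rwa [mk_pi] at this

theorem count_union_le (Y Y' : Set X) : count (Y ∪ Y') ≤ count Y * count Y' := by
  have h : ∀ (S : traces (Y ∪ Y')) (Z : Set X), Z ⊆ Y ∪ Y' → S.1 ∩ Z ∈ traces Z := by
    rintro ⟨S, F, hF, rfl⟩ Z hZ
    refine ⟨F, hF, ?_⟩
    rw [inter_assoc, inter_eq_self_of_subset_right hZ]
  have : count (Y ∪ Y') ≤ #(traces Y × traces Y') := by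
    refine mk_le_of_injective (f := fun S =>
      (⟨S.1 ∩ Y, h S _ subset_union_left⟩, ⟨S.1 ∩ Y', h S _ subset_union_right⟩)) ?_
    rintro S S' e
    have hs : ∀ T : traces (Y ∪ Y'), T.1 = T.1 ∩ Y ∪ T.1 ∩ Y' := by
      rintro ⟨T, F, hF, rfl⟩
      rw [← inter_union_distrib_left, inter_assoc, inter_self]
    refine Subtype.ext ?_
    rw [hs S, hs S']
    exact congrArg₂ _ (congrArg Subtype.val (congrArg Prod.fst e))
      (congrArg Subtype.val (congrArg Prod.snd e))
  simpa [count] using this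

/-- Traces on the separated pieces can be prescribed independently: the closure of their union cuts
out each of them again on its piece. -/
theorem prod_count_le {ι : Type u} (Y O : ι → Set X) (hO : ∀ i, IsOpen (O i))
    (hY : ∀ i, Y i ⊆ O i) (hd : ∀ i j, i ≠ j → O i ∩ Y j = ∅) :
    (prod fun i => count (Y i)) ≤ count (univ : Set X) := by
  have : #(∀ i, traces (Y i)) ≤ count (univ : Set X) := by
    refine mk_le_of_injective
      (f := fun S => (⟨closure (⋃ i, (S i).1), closure (⋃ i, (S i).1), isClosed_closure,
        (inter_univ _).symm⟩ :
        traces (univ : Set X))) ?_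
    intro S S' e
    have key : ∀ S : ∀ i, traces (Y i), ∀ i, (S i).1 = closure (⋃ i, (S i).1) ∩ Y i := by
      intro S i
      have hsub : ∀ j, (S j).1 ⊆ Y j := fun j => by
        obtain ⟨F, hF, hS⟩ := (S j).2
        rw [hS]; exact inter_subset_right
      refine Subset.antisymm
        (subset_inter ((subset_iUnion (fun i => (S i).1) i).trans subset_closure) (hsub i)) ?_
      rintro y ⟨hy, hyY⟩
      obtain ⟨F, hF, hS⟩ := (S i).2
      by_contra hyS
      have hyF : y ∉ F := fun h => hyS (by rw [hS]; exact ⟨h, hyY⟩)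
      obtain ⟨z, ⟨hzO, hzF⟩, hz⟩ := mem_closure_iff.1 hy (O i ∩ Fᶜ)
        ((hO i).inter hF.isOpen_compl) ⟨hY i hyY, hyF⟩
      obtain ⟨j, hj⟩ := mem_iUnion.1 hz
      by_cases hij : i = j
      · subst hij
        rw [hS] at hj
        exact hzF hj.1
      · have : z ∈ O i ∩ Y j := ⟨hzO, hsub j hj⟩
        rw [hd i j hij] at this
        exact this
    funext i
    refine Subtype.ext ?_
    rw [key S i, key S' i, show closure (⋃ i, (S i).1) = closure (⋃ i, (S' i).1) from
      congrArg Subtype.val e]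
  rwa [mk_pi] at this

theorem mk_le_count [T1Space X] (Y : Set X) : #Y ≤ count Y := by
  refine mk_le_of_injective (f := fun y : Y => (⟨{y.1}, {y.1}, isClosed_singleton, by simp⟩ :
    traces Y)) ?_
  intro y y' e
  exact Subtype.ext (singleton_injective (congrArg Subtype.val e))

theorem count_le_two_power {Y : Set X} {κ : Cardinal.{u}} (h : HasNetwork Y κ) :
    count Y ≤ 2 ^ κ := by
  obtain ⟨N, hN, h⟩ := h
  refine le_trans ?_ (power_le_power_left two_ne_zero hN)
  rw [← mk_set]
  refine mk_le_of_injective (f := fun S : traces Y => {M : N | M.1 ∩ S.1 = ∅}) ?_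
  have key : ∀ S : traces Y, S.1 = Y \ ⋃ M ∈ {M : N | M.1 ∩ S.1 = ∅}, M.1 := by
    rintro ⟨S, F, hF, hS⟩
    ext y
    simp only [mem_sdiff, mem_iUnion, mem_ofPred_eq, not_exists]
    constructor
    · intro hy
      refine ⟨by rw [hS] at hy; exact hy.2, fun M hM hyM => ?_⟩
      have : y ∈ M.1 ∩ S := ⟨hyM, hy⟩
      rw [hM] at this
      exact this
    · rintro ⟨hyY, hy⟩
      by_contra hyS
      have hyF : y ∈ Fᶜ := fun h => hyS (by rw [hS]; exact ⟨h, hyY⟩)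
      obtain ⟨M, hM, hyM, hMF⟩ := h y hyY _ hF.isOpen_compl hyF
      refine hy ⟨M, hM⟩ ?_ hyM
      rw [hS]
      refine eq_empty_of_forall_notMem fun z hz => hMF hz.1 hz.2.1
  intro S S' e
  refine Subtype.ext ?_
  rw [key S, key S']
  simp only at e
  rw [e]

theorem Disc.mono {D E : Set X} (h : Disc E) (hDE : D ⊆ E) : Disc D := by
  intro x hx
  obtain ⟨O, hO, hOE⟩ := h x (hDE hx)
  refine ⟨O, hO, Subset.antisymm ?_ ?_⟩
  · rw [← hOE]; exact inter_subset_inter_right _ hDE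
  · intro y hy
    have : x ∈ O ∩ E := by rw [hOE]; exact mem_singleton x
    rw [mem_singleton_iff.1 hy]
    exact ⟨this.1, hx⟩

/-- Each subset of a discrete set is the trace on it of its own closure. -/
theorem two_power_le_count {D Y : Set X} (h : Disc D) (hDY : D ⊆ Y) : 2 ^ #D ≤ count Y := by
  rw [← mk_set]
  refine mk_le_of_injective (f := fun T : Set D => (⟨closure (Subtype.val '' T) ∩ Y, _,
    isClosed_closure, rfl⟩ : traces Y)) ?_
  have key : ∀ T : Set D, T = {x : D | x.1 ∈ closure (Subtype.val '' T) ∩ Y} := by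
    intro T
    ext x
    constructor
    · exact fun hx => ⟨subset_closure ⟨x, hx, rfl⟩, hDY x.2⟩
    · rintro ⟨hx, -⟩
      obtain ⟨O, hO, hOD⟩ := h x x.2
      have hxO : x.1 ∈ O ∩ D := by rw [hOD]; exact mem_singleton _
      obtain ⟨z, hzO, ⟨z', hz', rfl⟩⟩ := mem_closure_iff.1 hx O hO hxO.1
      have : z'.1 ∈ O ∩ D := ⟨hzO, z'.2⟩
      rw [hOD] at this
      rwa [← Subtype.ext (mem_singleton_iff.1 this)]
  intro T T' e
  rw [key T, key T']
  have := congrArg Subtype.val e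
  simp only at this
  rw [this]

theorem HasNetwork.mono {Y Y' : Set X} {κ κ' : Cardinal.{u}} (h : HasNetwork Y κ) (hY : Y' ⊆ Y)
    (hκ : κ ≤ κ') : HasNetwork Y' κ' := by
  obtain ⟨N, hN, h⟩ := h
  exact ⟨N, hN.trans hκ, fun y hy => h y (hY hy)⟩

theorem NetworkLT.mono {Y Y' : Set X} {κ κ' : Cardinal.{u}} (h : NetworkLT Y κ) (hY : Y' ⊆ Y)
    (hκ : κ ≤ κ') : NetworkLT Y' κ' := by
  obtain ⟨e, he, h⟩ := h
  exact ⟨e, he.trans_le hκ, h.mono hY le_rfl⟩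

theorem hasNetwork_iUnion {ι : Type u} {Y : ι → Set X} {κ : ι → Cardinal.{u}}
    (h : ∀ i, HasNetwork (Y i) (κ i)) : HasNetwork (⋃ i, Y i) (sum κ) := by
  choose N hN h using h
  refine ⟨⋃ i, N i, mk_iUnion_le_sum_mk.trans (sum_le_sum _ _ hN), fun y hy O hO hyO => ?_⟩
  obtain ⟨i, hi⟩ := mem_iUnion.1 hy
  obtain ⟨M, hM, h1⟩ := h i y hi O hO hyO
  exact ⟨M, mem_iUnion.2 ⟨i, hM⟩, h1⟩

theorem HasNetwork.union {Y Y' : Set X} {κ κ' : Cardinal.{u}} (h : HasNetwork Y κ)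
    (h' : HasNetwork Y' κ') : HasNetwork (Y ∪ Y') (κ + κ') := by
  obtain ⟨N, hN, h⟩ := h
  obtain ⟨N', hN', h'⟩ := h'
  refine ⟨N ∪ N', (mk_union_le _ _).trans (add_le_add hN hN'), fun y hy O hO hyO => ?_⟩
  rcases hy with hy | hy
  · obtain ⟨M, hM, h1⟩ := h y hy O hO hyO
    exact ⟨M, Or.inl hM, h1⟩
  · obtain ⟨M, hM, h1⟩ := h' y hy O hO hyO
    exact ⟨M, Or.inr hM, h1⟩

theorem NetworkLT.union {Y Y' : Set X} {κ : Cardinal.{u}} (hκ : ℵ₀ ≤ κ) (h : NetworkLT Y κ)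
    (h' : NetworkLT Y' κ) : NetworkLT (Y ∪ Y') κ := by
  obtain ⟨e, he, h⟩ := h
  obtain ⟨e', he', h'⟩ := h'
  exact ⟨_, add_lt_of_lt hκ he he', h.union h'⟩

theorem networkLT_iUnion {ι : Type u} {Y : ι → Set X} {κ : Cardinal.{u}} (hκ : ℵ₀ ≤ κ)
    (hι : #ι < κ.ord.cof) (h : ∀ i, NetworkLT (Y i) κ) : NetworkLT (⋃ i, Y i) κ := by
  choose e he h using h
  refine ⟨_, (sum_le_mk_mul_iSup e).trans_lt (mul_lt_of_lt hκ (hι.trans_le ?_)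
    (iSup_lt_of_lt_cof_ord hι he)), hasNetwork_iUnion h⟩
  exact (Ordinal.cof_le_card _).trans (card_ord κ).le

theorem hasNetwork_mk (Y : Set X) : HasNetwork Y #Y :=
  ⟨(fun y => {y}) '' Y, mk_image_le, fun y hy _ _ hyO =>
    ⟨{y}, ⟨y, hy, rfl⟩, mem_singleton y, singleton_subset_iff.2 hyO⟩⟩

/-- The closures of the subsets of D form the network: take V ∩ D for a closed neighbourhood V
inside the given open set. -/
theorem hasNetwork_closure [RegularSpace X] (D : Set X) : HasNetwork (closure D) (2 ^ #D) := by
  refine ⟨range fun T : Set D => closure (Subtype.val '' T), ?_, fun y hy O hO hyO => ?_⟩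
  · exact mk_range_le.trans (mk_set).le
  · obtain ⟨V, hV, hVc, hVO⟩ := exists_mem_nhds_isClosed_subset (hO.mem_nhds hyO)
    refine ⟨_, ⟨{x : D | x.1 ∈ V}, rfl⟩, ?_, ?_⟩
    · rw [mem_closure_iff_nhds] at hy ⊢
      intro t ht
      obtain ⟨z, hz, hzD⟩ := hy _ (Filter.inter_mem ht hV)
      exact ⟨z, hz.1, ⟨z, hzD⟩, hz.2, rfl⟩
    · refine (closure_minimal ?_ hVc).trans hVO
      rintro _ ⟨z, hz, rfl⟩
      exact hz

theorem Disc.of_seq {ι : Type u} [LinearOrder ι] {x : ι → X} {B : ι → Set X}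
    (hB : ∀ ξ, IsOpen (B ξ)) (hx : ∀ ξ, x ξ ∈ B ξ) (hcl : ∀ ξ, x ξ ∉ closure (x '' Iio ξ))
    (hlt : ∀ η ξ, η < ξ → x ξ ∉ B η) : Function.Injective x ∧ Disc (range x) := by
  have hinj : Function.Injective x := by
    intro a b hab
    rcases lt_trichotomy a b with h | h | h
    · exact absurd (hab ▸ hx a) (hlt a b h)
    · exact h
    · exact absurd (hab ▸ hx b) (hlt b a h)
  refine ⟨hinj, ?_⟩
  rintro _ ⟨ξ, rfl⟩
  refine ⟨B ξ ∩ (closure (x '' Iio ξ))ᶜ, (hB ξ).inter isClosed_closure.isOpen_compl,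
    Subset.antisymm ?_ ?_⟩
  · rintro _ ⟨⟨h1, h2⟩, ⟨η, rfl⟩⟩
    rcases lt_trichotomy η ξ with h | rfl | h
    · exact absurd (subset_closure (mem_image_of_mem x (mem_Iio.2 h))) h2
    · rfl
    · exact absurd h1 (hlt ξ η h)
  · rintro _ rfl
    exact ⟨⟨hx ξ, hcl ξ⟩, ξ, rfl⟩

theorem exists_disc_of_legal {ι : Type u} [LinearOrder ι] [WellFoundedLT ι] [Nonempty X]
    (B : ι → X → Set X) (hB : ∀ ξ x, IsOpen (B ξ x))
    (h : ∀ ξ (h : ι → X), ∃ x ∈ B ξ x, x ∉ closure (h '' Iio ξ) ∧ ∀ η < ξ, x ∉ B η (h η)) :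
    ∃ x : ι → X, Function.Injective x ∧ Disc (range x) ∧ ∀ ξ, x ξ ∈ B ξ (x ξ) := by
  obtain ⟨f, hf⟩ := exists_wf_rec (ι := ι) (α := X)
    (fun ξ h x => x ∈ B ξ x ∧ x ∉ closure (h '' Iio ξ) ∧ ∀ η < ξ, x ∉ B η (h η))
    (by
      rintro ξ h h' a hh ⟨h1, h2, h3⟩
      have : h '' Iio ξ = h' '' Iio ξ := image_congr fun η hη => hh η hη
      exact ⟨h1, this ▸ h2, fun η hη => hh η hη ▸ h3 η hη⟩) (fun ξ k _ => h ξ k)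
  have := Disc.of_seq (fun ξ => hB ξ (f ξ)) (fun ξ => (hf ξ).1) (fun ξ => (hf ξ).2.1)
    (fun η ξ hη => (hf ξ).2.2 η hη)
  exact ⟨f, this.1, this.2, fun ξ => (hf ξ).1⟩

theorem Disc.subset_of_closure_eq [T1Space X] {D E : Set X} (hD : Disc D)
    (h : closure D = closure E) : D ⊆ E := by
  intro x hx
  obtain ⟨O, hO, hOD⟩ := hD x hx
  have hxO : x ∈ O ∩ D := by rw [hOD]; exact mem_singleton x
  have hxE : x ∈ closure E := h ▸ subset_closure hx
  obtain ⟨z, hzO, hzE⟩ := mem_closure_iff.1 hxE O hO hxO.1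
  have hzD : z ∈ closure (O ∩ D) := hO.inter_closure ⟨hzO, h ▸ subset_closure hzE⟩
  rw [hOD, closure_singleton] at hzD
  exact mem_singleton_iff.1 hzD ▸ hzE

/-- With `#V` legal moves at every stage, each g : ι → V steers the construction to its own discrete
sequence. A discrete set is determined by its closure, so one closed set arises from at most `#ι ^
#ι = 2 ^ #ι` sequences. -/
theorem power_le_count_mul [T1Space X] [Nonempty X] {ι V : Type u} [LinearOrder ι]
    [WellFoundedLT ι] (hι : ℵ₀ ≤ #ι) (B : ι → X → Set X) (hB : ∀ ξ x, IsOpen (B ξ x))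
    (h : ∀ ξ (h : ι → X),
      #V ≤ #{x | x ∈ B ξ x ∧ x ∉ closure (h '' Iio ξ) ∧ ∀ η < ξ, x ∉ B η (h η)}) :
    #V ^ #ι ≤ count (univ : Set X) * 2 ^ #ι := by
  classical
  have a0 : X := Classical.arbitrary X
  have h' : ∀ ξ (k : ι → X),
      Nonempty (V ↪ {x | x ∈ B ξ x ∧ x ∉ closure (k '' Iio ξ) ∧ ∀ η < ξ, x ∉ B η (k η)}) :=
    fun ξ k => h ξ k
  let mv := fun ξ k => (h' ξ k).some
  let tr : ι → (ι → X) → ι → X := fun ξ k η => if η < ξ then k η else a0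
  have htr : ∀ ξ (k k' : ι → X), (∀ η < ξ, k η = k' η) → tr ξ k = tr ξ k' := by
    intro ξ k k' hk
    funext η
    by_cases hη : η < ξ <;> simp [tr, hη, hk]
  have hex : ∀ g : ι → V, ∃ f : ι → X, ∀ ξ, f ξ = (mv ξ (tr ξ f) (g ξ)).1 := by
    intro g
    refine exists_wf_rec (fun ξ k x => x = (mv ξ (tr ξ k) (g ξ)).1) ?_ fun ξ k _ => ⟨_, rfl⟩
    intro ξ k k' a hk ha
    rw [ha, htr ξ k k' hk]
  choose x hx using hex
  have hleg : ∀ g ξ, x g ξ ∈ B ξ (x g ξ) ∧ x g ξ ∉ closure (x g '' Iio ξ) ∧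
      ∀ η < ξ, x g ξ ∉ B η (x g η) := by
    intro g ξ
    have h1 := (mv ξ (tr ξ (x g)) (g ξ)).2
    rw [mem_ofPred_eq, ← hx g ξ] at h1
    have h2 : tr ξ (x g) '' Iio ξ = x g '' Iio ξ :=
      image_congr fun η hη => if_pos (show η < ξ from hη)
    rw [h2] at h1
    refine ⟨h1.1, h1.2.1, fun η hη => ?_⟩
    have h3 := h1.2.2 η hη
    simpa only [tr, if_pos hη] using h3
  have hdisc := fun g => Disc.of_seq (fun ξ => hB ξ (x g ξ)) (fun ξ => (hleg g ξ).1)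
    (fun ξ => (hleg g ξ).2.1) (fun η ξ hη => (hleg g ξ).2.2 η hη)
  have hinj : Function.Injective x := by
    intro g g' e
    funext ξ
    have h1 := hx g ξ
    rw [e, hx g' ξ] at h1
    exact ((mv ξ _).injective (Subtype.ext h1)).symm
  let Φ : (ι → V) → traces (univ : Set X) := fun g =>
    ⟨closure (range (x g)), _, isClosed_closure, (inter_univ _).symm⟩
  rw [power_def]
  refine mk_le_mk_mul_of_mk_preimage_le Φ fun b => ?_
  by_cases hb : ∃ g, Φ g = b
  · obtain ⟨g₀, rfl⟩ := hb
    have hr : ∀ g, g ∈ Φ ⁻¹' {Φ g₀} → range (x g) ⊆ range (x g₀) := by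
      intro g hg
      exact (hdisc g).2.subset_of_closure_eq (congrArg Subtype.val (mem_singleton_iff.1 hg))
    have h1 : #(Φ ⁻¹' {Φ g₀}) ≤ #(ι → range (x g₀)) := by
      refine mk_le_of_injective (f := fun g ξ => ⟨x g.1 ξ, hr g.1 g.2 ⟨ξ, rfl⟩⟩) ?_
      intro g g' e
      refine Subtype.ext (hinj ?_)
      funext ξ
      exact congrArg Subtype.val (congrFun e ξ)
    refine h1.trans ?_
    rw [← power_def, ← power_self_eq hι]
    exact power_le_power_right mk_range_le
  · have : Φ ⁻¹' {b} = ∅ := eq_empty_of_forall_notMem fun g hg => hb ⟨g, hg⟩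
    rw [this]
    simp

/-- This is the coding scheme of both counting arguments: S is remembered as an index k and its
trace on `T k`, from which `rec k` rebuilds it. -/
theorem count_le_sum {Y : Set X} {K : Type u} (T : K → Set X) (hT : ∀ k, T k ⊆ Y)
    (rec : K → Set X → Set X) (h : ∀ S ∈ traces Y, ∃ k, rec k (S ∩ T k) = S) :
    count Y ≤ sum fun k => count (T k) := by
  choose k hk using fun S : traces Y => h S.1 S.2
  have hm : ∀ (S : traces Y) k, S.1 ∩ T k ∈ traces (T k) := by
    rintro ⟨S, F, hF, rfl⟩ k
    refine ⟨F, hF, ?_⟩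
    rw [inter_assoc, inter_eq_self_of_subset_right (hT k)]
  have : count Y ≤ #(Σ k, traces (T k)) := by
    refine mk_le_of_injective (f := fun S => ⟨k S, S.1 ∩ T (k S), hm S _⟩) ?_
    intro S S' e
    have key : ∀ s s' : Σ k, traces (T k), s = s' → rec s.1 s.2.1 = rec s'.1 s'.2.1 := by
      rintro s _ rfl; rfl
    refine Subtype.ext ?_
    rw [← hk S, ← hk S']
    exact key _ _ e
  rwa [mk_sigma] at this

end Basic

/-! ### Compact totally disconnected spaces -/

section Compact

variable {X : Type u} [TopologicalSpace X] [CompactSpace X] [T2Space X]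
  [TotallyDisconnectedSpace X]

/-- By compactness a network yields a base of the same size. For each separable pair of network
members one clopen set separating them is fixed; finitely many of these, intersected with a clopen
set inside the open part G of Y, shrink to any given neighbourhood in Y. -/
theorem HasNetwork.exists_base {Y : Set X} {κ : Cardinal.{u}} (h : HasNetwork Y κ)
    (hκ : ℵ₀ ≤ κ) (hY : IsLocallyClosed Y) : ∃ 𝓑 : Set (Set X), #𝓑 ≤ κ ∧ (∀ b ∈ 𝓑, IsOpen b) ∧
      ∀ y ∈ Y, ∀ O, IsOpen O → y ∈ O → ∃ b ∈ 𝓑, y ∈ b ∧ b ∩ Y ⊆ O := by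
  classical
  obtain ⟨N, hN, h⟩ := h
  obtain ⟨G, F, hG, hF, rfl⟩ := hY
  have he : ∀ M : Set X, ∃ e : Set X, IsClopen e ∧ ((∃ e, IsClopen e ∧ M ⊆ e ∧ e ⊆ G) →
      M ⊆ e ∧ e ⊆ G) := by
    intro M
    by_cases hM : ∃ e, IsClopen e ∧ M ⊆ e ∧ e ⊆ G
    · obtain ⟨e, h1, h2⟩ := hM
      exact ⟨e, h1, fun _ => h2⟩
    · exact ⟨univ, isClopen_univ, fun h => absurd h hM⟩
  choose e he he' using he
  have hc : ∀ p : N × N, ∃ c : Set X, IsClopen c ∧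
      ((∃ c, IsClopen c ∧ p.1.1 ⊆ c ∧ p.2.1 ∩ c = ∅) → p.1.1 ⊆ c ∧ p.2.1 ∩ c = ∅) := by
    intro p
    by_cases hp : ∃ c, IsClopen c ∧ p.1.1 ⊆ c ∧ p.2.1 ∩ c = ∅
    · obtain ⟨c, h1, h2⟩ := hp
      exact ⟨c, h1, fun _ => h2⟩
    · exact ⟨univ, isClopen_univ, fun h => absurd h hp⟩
  choose c hc hc' using hc
  refine ⟨range fun p : N × List (N × N) => e p.1 ∩ {x | ∀ q ∈ p.2, x ∈ c q}, ?_, ?_, ?_⟩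
  · refine mk_range_le.trans ?_
    rw [mk_prod, lift_id, lift_id]
    refine mul_le_of_le hκ hN ((mk_list_le_max _).trans (max_le hκ ?_))
    rw [mk_prod, lift_id]
    exact mul_le_of_le hκ hN hN
  · rintro _ ⟨⟨M, l⟩, rfl⟩
    refine (he M).isOpen.inter ?_
    have : {x | ∀ q ∈ l, x ∈ c q} = ⋂ q ∈ l.toFinset, c q := by ext; simp
    rw [this]
    exact isOpen_biInter_finset fun q _ => (hc q).isOpen
  · rintro y ⟨hyG, hyF⟩ O hO hyO
    obtain ⟨d, hd, hyd, hdG⟩ := compact_exists_isClopen_in_isOpen hG hyG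
    obtain ⟨M, hM, hyM, hMd⟩ := h y ⟨hyG, hyF⟩ d hd.isOpen hyd
    obtain ⟨hMe, heG⟩ := he' M ⟨d, hd, hMd, hdG⟩
    have hK : IsCompact (e M ∩ F ∩ Oᶜ) :=
      (((he M).isClosed.inter hF).inter hO.isClosed_compl).isCompact
    have hq : ∀ z ∈ e M ∩ F ∩ Oᶜ, ∃ q : N × N, y ∈ c q ∧ z ∉ c q := by
      rintro z ⟨⟨hze, hzF⟩, hzO⟩
      have hne : y ≠ z := fun e => hzO (e ▸ hyO)
      obtain ⟨d', hd', hyd', hzd'⟩ := compact_exists_isClopen_in_isOpen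
        (isOpen_compl_singleton (x := z)) (show y ∈ ({z} : Set X)ᶜ from hne)
      have hz : z ∈ d'ᶜ := fun hz => hzd' hz rfl
      obtain ⟨M₁, hM₁, hyM₁, hMd₁⟩ := h y ⟨hyG, hyF⟩ d' hd'.isOpen hyd'
      obtain ⟨M₂, hM₂, hzM₂, hMd₂⟩ := h z ⟨heG hze, hzF⟩ d'ᶜ hd'.compl.isOpen hz
      have := hc' (⟨M₁, hM₁⟩, ⟨M₂, hM₂⟩) ⟨d', hd', hMd₁,
        eq_empty_of_forall_notMem fun w hw => hMd₂ hw.1 hw.2⟩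
      refine ⟨(⟨M₁, hM₁⟩, ⟨M₂, hM₂⟩), this.1 hyM₁, fun hzc => ?_⟩
      have h3 : z ∈ M₂ ∩ c (⟨M₁, hM₁⟩, ⟨M₂, hM₂⟩) := ⟨hzM₂, hzc⟩
      exact (this.2 ▸ h3 : z ∈ (∅ : Set X))
    obtain ⟨t, ht⟩ := hK.elim_finite_subcover (fun q : {q : N × N // y ∈ c q} => (c q.1)ᶜ)
      (fun q => (hc q).compl.isOpen) (fun z hz => by
        obtain ⟨q, hq1, hq2⟩ := hq z hz
        exact mem_iUnion.2 ⟨⟨q, hq1⟩, hq2⟩)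
    refine ⟨_, ⟨(⟨M, hM⟩, t.toList.map Subtype.val), rfl⟩, ⟨hMe hyM, ?_⟩, ?_⟩
    · intro q hq
      obtain ⟨q', -, rfl⟩ := List.mem_map.1 hq
      exact q'.2
    · rintro z ⟨⟨hze, hzc⟩, hzG, hzF⟩
      by_contra hzO
      obtain ⟨q, hqt, hq⟩ := mem_iUnion₂.1 (ht ⟨⟨hze, hzF⟩, hzO⟩)
      exact hq (hzc q.1 (List.mem_map.2 ⟨q, by simpa using hqt, rfl⟩))

/-- The invariant is a clopen remainder that meets every `P n` in an infinite set. By directedness,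
when the remainder is cut in two, one half inherits the invariant and the other can be split off. -/
theorem exists_disjoint_clopen (P : ℕ → Set X) (hdir : ∀ n m, ∃ k, P k ⊆ P n ∩ P m)
    (hinf : ∀ n, (P n).Infinite) : ∃ C : ℕ → Set X, (∀ n, IsClopen (C n)) ∧
      (∀ n m, n ≠ m → C n ∩ C m = ∅) ∧ ∀ n, (C n ∩ P n).Nonempty := by
  let Inv : Set X → Prop := fun c => IsClopen c ∧ ∀ n, (P n ∩ c).Infinite
  have hsplit : ∀ c e, Inv c → IsClopen e → Inv (c ∩ e) ∨ Inv (c \ e) := by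
    intro c e hc he
    by_contra hcon
    push Not at hcon
    obtain ⟨h1, h2⟩ := hcon
    have h1' : ∃ n, (P n ∩ (c ∩ e)).Finite := by
      by_contra h
      push Not at h
      exact h1 ⟨hc.1.inter he, h⟩
    have h2' : ∃ n, (P n ∩ (c \ e)).Finite := by
      by_contra h
      push Not at h
      exact h2 ⟨hc.1.diff he, h⟩
    obtain ⟨n, hn⟩ := h1'
    obtain ⟨m, hm⟩ := h2'
    obtain ⟨k, hk⟩ := hdir n m
    refine hc.2 k ((hn.union hm).subset ?_)
    rintro x ⟨hx, hxc⟩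
    by_cases hxe : x ∈ e
    · exact Or.inl ⟨(hk hx).1, hxc, hxe⟩
    · exact Or.inr ⟨(hk hx).2, hxc, hxe⟩
  have hstep : ∀ n, ∀ c : {c // Inv c}, ∃ d : Set X, IsClopen d ∧ d ⊆ c.1 ∧ Inv (c.1 \ d) ∧
      (d ∩ P n).Nonempty := by
    rintro n ⟨c, hc⟩
    obtain ⟨x, hx⟩ := (hc.2 n).nonempty
    obtain ⟨y, hy, hyx⟩ := (hc.2 n).exists_notMem_finite (finite_singleton x)
    obtain ⟨e, he, hxe, hye⟩ := compact_exists_isClopen_in_isOpen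
        (isOpen_compl_singleton (x := y)) (show x ∈ ({y} : Set X)ᶜ from fun h => hyx h.symm)
    have hye' : y ∉ e := fun h => hye h rfl
    rcases hsplit c e hc he with h | h
    · refine ⟨c \ e, hc.1.diff he, sdiff_subset, ?_, y, ⟨hy.2, hye'⟩, hy.1⟩
      rwa [sdiff_sdiff_right_self]
    · refine ⟨c ∩ e, hc.1.inter he, inter_subset_left, ?_, x, ⟨hx.2, hxe⟩, hx.1⟩
      rwa [sdiff_self_inter]
  choose d hd hdc hdI hdP using hstep
  let c : ℕ → {c // Inv c} := fun n => Nat.rec ⟨univ, isClopen_univ, fun n => by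
    simpa using hinf n⟩ (fun n c => ⟨c.1 \ d n c, hdI n c⟩) n
  have hcs : ∀ n, (c (n + 1)).1 = (c n).1 \ d n (c n) := fun n => rfl
  have hanti : Antitone fun n => (c n).1 := antitone_nat_of_succ_le fun n => by
    rw [hcs]; exact sdiff_subset
  have hdisj : ∀ n m, n < m → d n (c n) ∩ d m (c m) = ∅ := by
    intro n m hnm
    refine eq_empty_of_forall_notMem fun x hx => ?_
    have h1 := hanti (Nat.succ_le_of_lt hnm) (hdc m _ hx.2)
    simp only [Nat.succ_eq_add_one, hcs] at h1
    exact h1.2 hx.1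
  refine ⟨fun n => d n (c n), fun n => hd _ _, fun n m hnm => ?_, fun n => hdP _ _⟩
  rcases lt_or_gt_of_ne hnm with h | h
  · exact hdisj n m h
  · rw [inter_comm]; exact hdisj m n h

end Compact
end TraceCount

/-! ### Bounds below a power gap -/

theorem Cardinal.PowerGap.exists_index_bound {κ μ : Cardinal.{u}} (hg : PowerGap κ μ)
    {ρ w : Cardinal.{u}} (hcof : ℵ₀ < ρ.ord.cof) (hρ : ρ < μ) (hw : w ≠ 0)
    (h : ∀ s < ρ, w ^ s < μ) : ∃ e < μ, ∀ {α : Type u} (𝓑 : Set α), #𝓑 ≤ w →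
      #(Σ ξ : ρ.ord.ToType, (Iio ξ → 𝓑)) ≤ e := by
  obtain ⟨e, he, hbd⟩ := hg.exists_uniform hcof (fun s e => w ^ s ≤ e)
    (fun s s' e e' hs he h => ((power_le_power_left hw hs).trans h).trans he)
    (fun s hs => ⟨_, h s hs, le_rfl⟩)
  refine ⟨ρ * e, mul_lt_of_lt hg.aleph0_lt.le hρ he, fun {α} 𝓑 h𝓑 => ?_⟩
  rw [mk_sigma]
  calc _ ≤ sum fun _ : ρ.ord.ToType => e := sum_le_sum _ _ fun ξ => by
        rw [← power_def]
        exact (power_le_power_right h𝓑).trans (hbd _ (mk_Iio_toType_lt ξ))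
    _ = ρ * e := by rw [sum_const', mk_ord_toType]

theorem Cardinal.mk_setOf_exists_lt {α : Type u} {c : Cardinal.{u}} (hc : ℵ₀ ≤ c) (U : ℕ → Set α)
    (m : ℕ) (h : ∀ n < m, #(U n) < c) : #{x | ∃ n < m, x ∈ U n} < c := by
  induction m with
  | zero => simpa using aleph0_pos.trans_le hc
  | succ m ih =>
    have : {x | ∃ n < m + 1, x ∈ U n} ⊆ {x | ∃ n < m, x ∈ U n} ∪ U m := by
      rintro x ⟨n, hn, hx⟩
      rcases Nat.lt_succ_iff_lt_or_eq.1 hn with h | rfl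
      · exact Or.inl ⟨n, h, hx⟩
      · exact Or.inr hx
    refine (mk_le_mk_of_subset this).trans_lt ((mk_union_le _ _).trans_lt ?_)
    exact add_lt_of_lt hc (ih fun n hn => h n (hn.trans (Nat.lt_succ_self m)))
      (h m (Nat.lt_succ_self m))

namespace TraceCount

variable {X : Type u} [TopologicalSpace X] {μ : Cardinal.{u}}

/-- Let σ be least with μ ≤ 2 ^ σ. If Z had no small network, points could be chosen for σ steps off
the closure and the neighbourhoods of the earlier ones, as fewer than σ points never exhaust Z. The
resulting discrete set gives 2 ^ σ closed sets, a power in the forbidden interval. -/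
theorem networkLT_of_locally_count_le [T3Space X] [Nonempty X]
    (hg : PowerGap (count (univ : Set X)) μ) {Z : Set X} {ν : Cardinal.{u}} (hν : ν < μ)
    (hZ : ∀ x ∈ Z, ∃ O, IsOpen O ∧ x ∈ O ∧ count O ≤ ν) : NetworkLT Z μ := by
  classical
  by_contra hcon
  let S : Set Cardinal.{u} := {s | μ ≤ 2 ^ s}
  have hS : S.Nonempty := ⟨μ, (cantor μ).le⟩
  let σ := (wellFounded_lt (α := Cardinal.{u})).min S hS
  have hσ : μ ≤ 2 ^ σ := (wellFounded_lt (α := Cardinal.{u})).min_mem S hS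
  have hlt : ∀ s < σ, 2 ^ s < μ := fun s hs => by
    by_contra hc
    exact absurd hs ((wellFounded_lt (α := Cardinal.{u})).min_le (s := S) (not_lt.1 hc)).not_gt
  have hσω : ℵ₀ ≤ σ := by
    by_contra hc
    have h1 := power_lt_aleph0 (natCast_lt_aleph0 (n := 2)) (not_le.1 hc)
    exact absurd hg.aleph0_lt ((hσ.trans h1.le).not_gt)
  let ι := σ.ord.ToType
  have hO : ∀ x, ∃ O : Set X, IsOpen O ∧ (x ∈ Z → x ∈ O) ∧ count O ≤ max ν 1 ∧
      (x ∉ Z → O = ∅) := by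
    intro x
    by_cases hx : x ∈ Z
    · obtain ⟨O, h1, h2, h3⟩ := hZ x hx
      exact ⟨O, h1, fun _ => h2, h3.trans (le_max_left _ _), fun h => absurd hx h⟩
    · refine ⟨∅, isOpen_empty, fun h => absurd h hx, ?_, fun _ => rfl⟩
      refine (count_le_two_power (hasNetwork_mk ∅)).trans ?_
      simp
  choose O hOo hxO hOc hOe using hO
  have hone : 1 < μ := one_lt_aleph0.trans hg.aleph0_lt
  obtain ⟨x, hxi, hxd, hxB⟩ := exists_disc_of_legal (ι := ι) (fun _ x => O x)
    (fun _ x => hOo x) (by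
      intro ξ h
      by_contra hc
      push Not at hc
      refine hcon (NetworkLT.mono (Y := closure (h '' Iio ξ) ∪ ⋃ η : Iio ξ, O (h η)) (κ := μ)
        ?_ ?_ le_rfl)
      · refine NetworkLT.union hg.aleph0_lt.le ⟨_, ?_, hasNetwork_closure _⟩
          ⟨_, ?_, hasNetwork_iUnion fun η => hasNetwork_mk _⟩
        · exact (power_le_power_left two_ne_zero mk_image_le).trans_lt
            (hlt _ (mk_Iio_toType_lt ξ))
        · calc _ ≤ sum fun _ : Iio ξ => max ν 1 :=
                sum_le_sum _ _ fun η => (mk_le_count _).trans (hOc _)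
            _ < μ := by
              rw [sum_const']
              exact mul_lt_of_lt hg.aleph0_lt.le
                ((cantor _).trans (hlt _ (mk_Iio_toType_lt ξ))) (max_lt hν hone)
      · intro z hz
        by_contra hz'
        simp only [mem_union, mem_iUnion, not_or, not_exists] at hz'
        obtain ⟨η, hη, hzη⟩ := hc z (hxO z hz) hz'.1
        exact hz'.2 ⟨η, hη⟩ hzη)
  have h1 := two_power_le_count hxd (subset_univ _)
  rw [mk_range_eq _ hxi, mk_ord_toType] at h1
  exact absurd (hg.power_lt hσω h1) hσ.not_gt

/-- The points of `P` having a neighbourhood in `P` with a network of fewer than `W` sets. -/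
def tame (W : Cardinal.{u}) (P : Set X) : Set X :=
  {x | x ∈ P ∧ ∃ O, IsOpen O ∧ x ∈ O ∧ NetworkLT (O ∩ P) W}

/-- `e` bounds the number of traces on every locally closed `Y ⊆ Z` having a network of at most `w`
sets. -/
def CountBound (Z : Set X) (w e : Cardinal.{u}) : Prop :=
  ∀ Y ⊆ Z, IsLocallyClosed Y → HasNetwork Y w → count Y ≤ e


section Tree

variable [T3Space X] [Nonempty X] {W : Cardinal.{u}}

/-- Were there always W legal moves, `power_le_count_mul` would give W ^ cof W ≤ κ, the factor 2 ^
cof W being absorbed, although this power reaches μ. -/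
theorem not_tree (hg : PowerGap (count (univ : Set X)) μ) (hcof : ℵ₀ < W.ord.cof) (hWμ : W < μ)
    (h2 : 2 ^ W.ord.cof < W) (hW : μ ≤ W ^ W.ord.cof)
    (B : W.ord.cof.ord.ToType → X → Set X) (hB : ∀ ξ x, IsOpen (B ξ x)) :
    ∃ ξ, ∃ h : W.ord.cof.ord.ToType → X,
      #{x | x ∈ B ξ x ∧ x ∉ closure (h '' Iio ξ) ∧ ∀ η < ξ, x ∉ B η (h η)} < W := by
  by_contra hcon
  push Not at hcon
  have h1 := power_le_count_mul (V := W.ord.ToType) (ι := W.ord.cof.ord.ToType)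
    (by rw [mk_ord_toType]; exact hcof.le) B hB (by simpa using hcon)
  rw [mk_ord_toType, mk_ord_toType] at h1
  rw [mul_eq_left (hg.aleph0_lt.le.trans hg.le) ((h2.trans hWμ).le.trans hg.le)
    (power_ne_zero _ two_ne_zero)] at h1
  exact absurd (hg.power_lt hcof.le h1) hW.not_gt

/-- At the stage given by `not_tree`, Y is covered by fewer than W legal points, the closure of
fewer than cof W points, and fewer than cof W neighbourhoods whose traces on Y have small networks.
-/
theorem networkLT_of_locally (hg : PowerGap (count (univ : Set X)) μ) (hcof : ℵ₀ < W.ord.cof)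
    (hWμ : W < μ) (h2 : 2 ^ W.ord.cof < W) (hW : μ ≤ W ^ W.ord.cof) {Y : Set X}
    (hY : ∀ y ∈ Y, ∃ O, IsOpen O ∧ y ∈ O ∧ NetworkLT (O ∩ Y) W) : NetworkLT Y W := by
  classical
  have hWω : ℵ₀ ≤ W := (hcof.trans ((cantor _).trans h2)).le
  have hO : ∀ x, ∃ O : Set X, IsOpen O ∧ (x ∈ Y → x ∈ O) ∧ NetworkLT (O ∩ Y) W := by
    intro x
    by_cases hx : x ∈ Y
    · obtain ⟨O, h1, h2, h3⟩ := hY x hx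
      exact ⟨O, h1, fun _ => h2, h3⟩
    · refine ⟨∅, isOpen_empty, fun h => absurd h hx, 0, aleph0_pos.trans_le hWω, ?_⟩
      simpa using hasNetwork_mk (∅ : Set X)
  choose O hOo hxO hOn using hO
  obtain ⟨ξ, h, hlt⟩ := not_tree hg hcof hWμ h2 hW (fun _ x => O x) (fun _ x => hOo x)
  have hn : NetworkLT (⋃ η : Iio ξ, O (h η) ∩ Y) W :=
    networkLT_iUnion hWω (mk_Iio_toType_lt ξ) fun η => hOn _
  have hc : NetworkLT (closure (h '' Iio ξ)) W := ⟨_, (power_le_power_left two_ne_zero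
    (mk_image_le.trans (mk_Iio_toType_lt ξ).le)).trans_lt h2, hasNetwork_closure _⟩
  refine ((NetworkLT.union hWω ⟨_, hlt, hasNetwork_mk _⟩ hc).union hWω hn).mono ?_ le_rfl
  intro y hy
  by_cases h1 : y ∈ closure (h '' Iio ξ)
  · exact Or.inl (Or.inr h1)
  by_cases h3 : ∃ η < ξ, y ∈ O (h η)
  · obtain ⟨η, hη, hyη⟩ := h3
    exact Or.inr (mem_iUnion.2 ⟨⟨η, hη⟩, hyη, hy⟩)
  · push Not at h3
    exact Or.inl (Or.inl ⟨hxO y hy, h1, h3⟩)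

end Tree
end TraceCount

namespace TraceCount

variable {X : Type u} [TopologicalSpace X] {μ : Cardinal.{u}}

theorem CountBound.mono {Z : Set X} {w w' e e' : Cardinal.{u}} (h : CountBound Z w e)
    (hw : w' ≤ w) (he : e ≤ e') : CountBound Z w' e' :=
  fun Y hY hc hn => (h Y hY hc (hn.mono Subset.rfl hw)).trans he

theorem isLocallyClosed_tame {W : Cardinal.{u}} {P : Set X} (hP : IsLocallyClosed P) :
    IsLocallyClosed (tame W P) := by
  have : tame W P = P ∩ ⋃₀ {O | IsOpen O ∧ NetworkLT (O ∩ P) W} := by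
    ext x
    constructor
    · rintro ⟨h, O, hO, hx, hn⟩
      exact ⟨h, O, ⟨hO, hn⟩, hx⟩
    · rintro ⟨h, O, ⟨hO, hn⟩, hx⟩
      exact ⟨h, O, hO, hx, hn⟩
  rw [this]
  exact hP.inter (isOpen_sUnion fun O h => h.1).isLocallyClosed

variable [CompactSpace X] [T2Space X] [TotallyDisconnectedSpace X]

/-- From Y remove fewer than cof W basic sets disjoint from S, until every non-tame point of the
rest P lies in S. Then S is its trace on the tame part together with the whole non-tame part. The
tame part has a network smaller than W, so the induction hypothesis counts its traces. -/
theorem exists_countBound_of_two_power_lt [Nonempty X] (hg : PowerGap (count (univ : Set X)) μ) {Z : Set X}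
    {w W : Cardinal.{u}} (hw : ℵ₀ ≤ w) (hWw : W ≤ w) (hwμ : w < μ) (hcof : ℵ₀ < W.ord.cof)
    (h2 : 2 ^ W.ord.cof < W) (hW : μ ≤ W ^ W.ord.cof) (hs : ∀ s < W.ord.cof, w ^ s < μ)
    (ih : ∀ w' < W, ∃ e < μ, CountBound Z w' e) : ∃ e < μ, CountBound Z w e := by
  classical
  have hWμ := hWw.trans_lt hwμ
  have hWω : ℵ₀ ≤ W := (hcof.trans ((cantor _).trans h2)).le
  obtain ⟨e₁, he₁, hbd₁⟩ := hg.exists_uniform hcof (CountBound Z)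
    (fun s s' e e' hs he h => h.mono hs he) ih
  obtain ⟨e₂, he₂, hbd₂⟩ := hg.exists_index_bound (ρ := W.ord.cof) (w := w)
    (by rwa [Ordinal.cof_ord_cof]) (((cantor _).trans h2).trans hWμ)
    (aleph0_pos.trans_le hw).ne' hs
  refine ⟨e₂ * e₁, mul_lt_of_lt hg.aleph0_lt.le he₂ he₁, fun Y hYZ hYc hYn => ?_⟩
  obtain ⟨𝓑, h𝓑, h𝓑o, hbase⟩ := hYn.exists_base hw hYc
  let ι := W.ord.cof.ord.ToType
  let P : (Σ ξ : ι, (Iio ξ → 𝓑)) → Set X := fun k => Y \ ⋃ η, (k.2 η).1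
  have hPY : ∀ k, P k ⊆ Y := fun k => sdiff_subset
  have htame : ∀ k, NetworkLT (tame W (P k)) W := by
    intro k
    refine networkLT_of_locally hg hcof hWμ h2 hW ?_
    rintro y ⟨hy, O, hO, hyO, hn⟩
    exact ⟨O, hO, hyO, hn.mono (inter_subset_inter_right _ fun _ h => h.1) le_rfl⟩
  have htc : ∀ k, count (tame W (P k)) ≤ e₁ := by
    intro k
    obtain ⟨s, hs, hn⟩ := htame k
    refine hbd₁ s hs _ (fun y hy => hYZ (hPY k hy.1)) (isLocallyClosed_tame ?_) hn
    rw [show P k = Y ∩ (⋃ η, (k.2 η).1)ᶜ from rfl]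
    exact hYc.inter (isOpen_iUnion fun η => h𝓑o _ (k.2 η).2).isClosed_compl.isLocallyClosed
  refine (count_le_sum (fun k => tame W (P k)) (fun k y hy => hPY k hy.1)
    (fun k S => S ∪ (P k \ tame W (P k))) ?_).trans ?_
  · rintro S ⟨F, hF, hSF⟩
    by_contra hcon
    push Not at hcon
    obtain ⟨f, hf⟩ := exists_wf_rec (ι := ι) (α := Set X)
      (fun ξ k b => b ∈ 𝓑 ∧ b ∩ S = ∅ ∧
        ∃ x ∈ b, x ∈ (Y \ ⋃ η : Iio ξ, k η) \ tame W (Y \ ⋃ η : Iio ξ, k η))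
      (by
        rintro ξ k k' b hk ⟨h1, h2, h3⟩
        have : ⋃ η : Iio ξ, k η = ⋃ η : Iio ξ, k' η := iUnion_congr fun η => hk η η.2
        exact ⟨h1, h2, this ▸ h3⟩) (by
        intro ξ k hk
        let kk : Σ ξ : ι, (Iio ξ → 𝓑) := ⟨ξ, fun η => ⟨k η, (hk η η.2).1⟩⟩
        by_contra hno
        push Not at hno
        have hPk : Y \ ⋃ η : Iio ξ, k η = P kk := rfl
        rw [hPk] at hno
        have hker : P kk \ tame W (P kk) ⊆ S := by
          intro x hx
          by_contra hxS
          have hxF : x ∈ Fᶜ := fun h => hxS (by rw [hSF]; exact ⟨h, hPY _ hx.1⟩)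
          obtain ⟨b, hb, hxb, hbY⟩ := hbase x (hPY _ hx.1) _ hF.isOpen_compl hxF
          refine hno b hb (eq_empty_of_forall_notMem fun z hz => ?_) x hxb hx
          have hzS := hz.2
          rw [hSF] at hzS
          exact hbY ⟨hz.1, hzS.2⟩ hzS.1
        have hSP : S ⊆ P kk := by
          intro z hz
          refine ⟨?_, fun hzU => ?_⟩
          · rw [hSF] at hz; exact hz.2
          · obtain ⟨η, hη⟩ := mem_iUnion.1 hzU
            have hz2 : z ∈ k η ∩ S := ⟨hη, hz⟩
            rw [(hk η η.2).2.1] at hz2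
            exact hz2
        refine hcon kk (Subset.antisymm (union_subset inter_subset_left hker) fun z hz => ?_)
        by_cases hzt : z ∈ tame W (P kk)
        · exact Or.inl ⟨hz, hzt⟩
        · exact Or.inr ⟨hSP hz, hzt⟩)
    -- Here the neighbourhoods depend on the stage only. At the stage obtained, `f ξ` meets the
    -- remaining set in a set with a small network, so the non-tame point chosen in `f ξ` is tame.
    obtain ⟨ξ, h, hlt⟩ := not_tree hg hcof hWμ h2 hW (fun ξ _ => f ξ) (fun ξ _ => h𝓑o _ (hf ξ).1)
    obtain ⟨x, hxf, hxP, hxt⟩ := (hf ξ).2.2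
    refine hxt ⟨hxP, f ξ, h𝓑o _ (hf ξ).1, hxf, ?_⟩
    have hc : NetworkLT (closure (h '' Iio ξ)) W := ⟨_, (power_le_power_left two_ne_zero
      (mk_image_le.trans (mk_Iio_toType_lt ξ).le)).trans_lt h2, hasNetwork_closure _⟩
    refine (NetworkLT.union hWω ⟨_, hlt, hasNetwork_mk _⟩ hc).mono ?_ le_rfl
    rintro y ⟨hyf, -, hyU⟩
    by_cases h1 : y ∈ closure (h '' Iio ξ)
    · exact Or.inr h1
    · exact Or.inl ⟨hyf, h1, fun η hη hy => hyU (mem_iUnion.2 ⟨⟨η, hη⟩, hy⟩)⟩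
  · calc _ ≤ sum fun _ : (Σ ξ : ι, (Iio ξ → 𝓑)) => e₁ := sum_le_sum _ _ htc
      _ ≤ e₂ * e₁ := by
        rw [sum_const']
        exact mul_le_mul_left (hbd₂ 𝓑 h𝓑) _

/-- Basic sets whose traces on S are pairwise disjoint are chosen, each meeting S off the closure of
what the earlier ones cover of S. Running for ρ steps would give a discrete set of size ρ, so at
some stage the covered part is dense in S. That part lies in the separated pieces `Q k η`, whose
counts multiply to at most κ and are bounded by `exists_prod_bound`. -/
theorem exists_countBound_of_no_disc (hg : PowerGap (count (univ : Set X)) μ) {Z : Set X}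
    {w ρ ν : Cardinal.{u}} (hw : ℵ₀ ≤ w) (hcof : ℵ₀ < ρ.ord.cof)
    (hρ : ρ < μ) (hs : ∀ s < ρ, w ^ s < μ) (hD : ∀ D ⊆ Z, Disc D → #D ≠ ρ) (hν : ν < μ)
    (hZ : ∀ x ∈ Z, ∃ O, IsOpen O ∧ x ∈ O ∧ count O ≤ ν) : ∃ e < μ, CountBound Z w e := by
  classical
  obtain ⟨e₁, he₁, hbd₁⟩ := hg.exists_uniform hcof
    (fun t e => ∀ (ι : Type u) (n : ι → Cardinal.{u}), #ι ≤ t →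
      (∀ b, 1 ≤ n b) → (∀ b, n b ≤ ν) → prod n ≤ count (univ : Set X) → prod n ≤ e)
    (fun s s' e e' hs he h ι n hι h1 h2 h3 => (h ι n (hι.trans hs) h1 h2 h3).trans he)
    (fun t ht => hg.exists_prod_bound hν t ((power_le_power_right
      ((natCast_lt_aleph0 (n := 2)).le.trans hw)).trans_lt (hs t ht)))
  obtain ⟨e₂, he₂, hbd₂⟩ := hg.exists_index_bound (w := w) hcof hρ
    (aleph0_pos.trans_le hw).ne' hs
  refine ⟨e₂ * e₁, mul_lt_of_lt hg.aleph0_lt.le he₂ he₁, fun Y hYZ hYc hYn => ?_⟩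
  obtain ⟨𝓑', h𝓑', h𝓑o', hbase'⟩ := hYn.exists_base hw hYc
  let 𝓑 : Set (Set X) := {b | b ∈ 𝓑' ∧ count (Y ∩ b) ≤ ν}
  have h𝓑 : #𝓑 ≤ w := (mk_le_mk_of_subset fun b hb => hb.1).trans h𝓑'
  have h𝓑o : ∀ b ∈ 𝓑, IsOpen b := fun b hb => h𝓑o' b hb.1
  have hbase : ∀ y ∈ Y, ∀ O, IsOpen O → y ∈ O → ∃ b ∈ 𝓑, y ∈ b ∧ b ∩ Y ⊆ O := by
    intro y hy O hO hyO
    obtain ⟨O', hO', hyO', hc⟩ := hZ y (hYZ hy)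
    obtain ⟨b, hb, hyb, hbY⟩ := hbase' y hy (O ∩ O') (hO.inter hO') ⟨hyO, hyO'⟩
    refine ⟨b, ⟨hb, (count_mono fun z hz => ?_).trans hc⟩, hyb, fun z hz => (hbY hz).1⟩
    exact (hbY ⟨hz.2, hz.1⟩).2
  let ι := ρ.ord.ToType
  let Q : (k : Σ ξ : ι, (Iio ξ → 𝓑)) → Iio k.1 → Set X := fun k η =>
    (Y ∩ (k.2 η).1) \ ⋃ ζ, ⋃ _ : ζ ≠ η, (k.2 ζ).1
  have hQc : ∀ k, count (⋃ η, Q k η) ≤ e₁ := by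
    intro k
    refine (count_iUnion_le _).trans (hbd₁ _ (mk_Iio_toType_lt k.1) _ _ le_rfl
      (fun η => one_le_count _) (fun η => ?_) ?_)
    · exact (count_mono sdiff_subset).trans (k.2 η).2.2
    · refine prod_count_le (Q k) (fun η => (k.2 η).1) (fun η => h𝓑o _ (k.2 η).2)
        (fun η z hz => hz.1.2) fun i j hij => ?_
      refine eq_empty_of_forall_notMem fun z hz => hz.2.2 ?_
      exact mem_iUnion₂.2 ⟨i, hij, hz.1⟩
  refine (count_le_sum (fun k => ⋃ η, Q k η) (fun k => iUnion_subset fun η z hz => hz.1.1)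
    (fun k S => closure S ∩ Y) ?_).trans ?_
  · rintro S ⟨F, hF, hSF⟩
    have hSF' : S ⊆ F := hSF ▸ inter_subset_left
    have hSY : S ⊆ Y := hSF ▸ inter_subset_right
    by_contra hcon
    push Not at hcon
    obtain ⟨f, hf⟩ := exists_wf_rec (ι := ι) (α := Set X)
      (fun ξ k b => b ∈ 𝓑 ∧ (∀ η < ξ, b ∩ k η ∩ S = ∅) ∧
        ∃ x ∈ S ∩ b, x ∉ closure (S ∩ ⋃ η : Iio ξ, k η))
      (by
        rintro ξ k k' b hk ⟨h1, h2, h3⟩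
        have : ⋃ η : Iio ξ, k η = ⋃ η : Iio ξ, k' η := iUnion_congr fun η => hk η η.2
        exact ⟨h1, fun η hη => hk η hη ▸ h2 η hη, this ▸ h3⟩) (by
        intro ξ k hk
        let kk : Σ ξ : ι, (Iio ξ → 𝓑) := ⟨ξ, fun η => ⟨k η, (hk η η.2).1⟩⟩
        have hpd : ∀ η < ξ, ∀ ζ < ξ, ζ ≠ η → ∀ z ∈ S, z ∈ k η → z ∉ k ζ := by
          intro η hη ζ hζ hne z hz hzη hzζ
          rcases lt_or_gt_of_ne hne with h | h
          · have : z ∈ k η ∩ k ζ ∩ S := ⟨⟨hzη, hzζ⟩, hz⟩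
            rw [(hk η hη).2.1 ζ h] at this
            exact this
          · have : z ∈ k ζ ∩ k η ∩ S := ⟨⟨hzζ, hzη⟩, hz⟩
            rw [(hk ζ hζ).2.1 η h] at this
            exact this
        have hsub : S ∩ ⋃ η : Iio ξ, k η ⊆ S ∩ ⋃ η, Q kk η := by
          rintro z ⟨hz, hzU⟩
          obtain ⟨η, hη⟩ := mem_iUnion.1 hzU
          refine ⟨hz, mem_iUnion.2 ⟨η, ⟨hSY hz, hη⟩, fun hz2 => ?_⟩⟩
          obtain ⟨ζ, hne, hζ⟩ := mem_iUnion₂.1 hz2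
          exact hpd η η.2 ζ ζ.2 (fun e => hne (Subtype.ext e)) z hz hη hζ
        have hno : ¬ S ⊆ closure (S ∩ ⋃ η : Iio ξ, k η) := by
          intro hS
          refine hcon kk (Subset.antisymm ?_ fun z hz =>
            ⟨closure_mono hsub (hS hz), hSY hz⟩)
          rintro z ⟨hz, hzY⟩
          rw [hSF]
          exact ⟨closure_minimal (inter_subset_left.trans hSF') hF hz, hzY⟩
        obtain ⟨x, hxS, hx⟩ := not_subset.1 hno
        obtain ⟨b, hb, hxb, hbY⟩ := hbase x (hSY hxS) _ isClosed_closure.isOpen_compl hx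
        refine ⟨b, hb, fun η hη => eq_empty_of_forall_notMem ?_, x, ⟨hxS, hxb⟩, hx⟩
        rintro z ⟨⟨hzb, hzη⟩, hzS⟩
        exact hbY ⟨hzb, hSY hzS⟩ (subset_closure ⟨hzS, mem_iUnion.2 ⟨⟨η, hη⟩, hzη⟩⟩))
    choose x hx hxc using fun ξ => (hf ξ).2.2
    obtain ⟨hinj, hdisc⟩ := Disc.of_seq (x := x) (B := f) (fun ξ => h𝓑o _ (hf ξ).1)
      (fun ξ => (hx ξ).2) (fun ξ hc => hxc ξ (closure_mono (by
        rintro _ ⟨η, hη, rfl⟩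
        exact ⟨(hx η).1, mem_iUnion.2 ⟨⟨η, hη⟩, (hx η).2⟩⟩) hc)) (by
        intro η ξ hη hmem
        have : x ξ ∈ f ξ ∩ f η ∩ S := ⟨⟨(hx ξ).2, hmem⟩, (hx ξ).1⟩
        rw [(hf ξ).2.1 η hη] at this
        exact this)
    refine hD (range x) ?_ hdisc ?_
    · rintro _ ⟨ξ, rfl⟩
      exact hYZ (hSY (hx ξ).1)
    · rw [mk_range_eq _ hinj, mk_ord_toType]
  · calc _ ≤ sum fun _ : (Σ ξ : ι, (Iio ξ → 𝓑)) => e₁ := sum_le_sum _ _ hQc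
      _ ≤ e₂ * e₁ := by
        rw [sum_const']
        exact mul_le_mul_left (hbd₂ 𝓑 h𝓑) _

end TraceCount

/-! ### Discrete sets at a cardinal of countable cofinality, and the induction -/

namespace TraceCount

variable {X : Type u} [TopologicalSpace X] {μ : Cardinal.{u}}

/-- Discrete sets of regular sizes cofinal in ρ would be thinned to sets of the same sizes whose
union is still discrete. That union has at least ρ points, so 2 ^ ρ ≤ κ, which the gap forbids. -/
theorem not_forall_exists_disc (hg : PowerGap (count (univ : Set X)) μ) {Z : Set X}
    {ρ ν : Cardinal.{u}} (hν : ν < μ) (hZ : ∀ x ∈ Z, ∃ O, IsOpen O ∧ x ∈ O ∧ count O ≤ ν)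
    (hρω : ℵ₀ < ρ) (hcof : ρ.ord.cof = ℵ₀) (hρ : μ ≤ 2 ^ ρ) :
    ¬ ∀ τ < ρ, ∃ D ⊆ Z, Disc D ∧ #D = τ := by
  classical
  intro hD
  obtain ⟨C, g, hC, hgρ, hgc, -, hsum⟩ := exists_cofinal_family hρω hcof.ge
  rw [hcof] at hC
  have hsucc : ∀ a < ρ, Order.succ (max a ℵ₀) < ρ := by
    intro a ha
    refine lt_of_le_of_ne (Order.succ_le_of_lt (max_lt ha hρω)) fun e => ?_
    have h1 := (isRegular_succ (le_max_right a ℵ₀)).cof_ord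
    rw [e, hcof] at h1
    exact hρω.ne h1
  have hτ : ∃ τ < ρ, ν < 2 ^ τ := by
    by_contra hcon
    push Not at hcon
    have h1 : (2 : Cardinal.{u}) ^ ρ ≤ ν ^ ℵ₀ := by
      refine (power_le_power_left two_ne_zero hsum).trans ?_
      rw [power_sum, ← hC, ← prod_const']
      exact prod_le_prod _ _ fun c => hcon _ (hgρ c)
    exact absurd (hg.small ν hν) (hρ.trans h1).not_gt
  obtain ⟨τ, hτρ, hντ⟩ := hτ
  -- As ν < 2 ^ τ, a neighbourhood with at most ν traces contains fewer than k points of a discrete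
  -- set. Regularity and uncountability of k bound the colours used later.
  let k := Order.succ (max τ ℵ₀)
  have hk : k.IsRegular := isRegular_succ (le_max_right _ _)
  have hkρ : k < ρ := hsucc τ hτρ
  have hτk : τ < k := (le_max_left _ _).trans_lt (Order.lt_succ _)
  have hωk : ℵ₀ < k := (le_max_right _ _).trans_lt (Order.lt_succ _)
  obtain ⟨e⟩ := Cardinal.eq.1 (show #C = #(ULift.{u} ℕ) by simp [hC])
  let gn : ℕ → Cardinal.{u} := fun n => g (e.symm ⟨n⟩)
  let lam : ℕ → Cardinal.{u} := fun n => Nat.rec (Order.succ (max (max (gn 0) k) ℵ₀))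
    (fun n l => Order.succ (max (max (gn (n + 1)) l) ℵ₀)) n
  have hlamS : ∀ n, lam (n + 1) = Order.succ (max (max (gn (n + 1)) (lam n)) ℵ₀) := fun n => rfl
  have hlam : ∀ n, lam n < ρ ∧ (lam n).IsRegular ∧ gn n ≤ lam n ∧ k < lam n := by
    intro n
    induction n with
    | zero =>
      refine ⟨hsucc _ (max_lt (hgρ _) hkρ), isRegular_succ (le_max_right _ _),
        ((le_max_left _ _).trans (le_max_left _ _)).trans (Order.le_succ _),
        ((le_max_right _ _).trans (le_max_left _ _)).trans_lt (Order.lt_succ _)⟩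
    | succ n ih =>
      rw [hlamS]
      refine ⟨hsucc _ (max_lt (hgρ _) ih.1), isRegular_succ (le_max_right _ _),
        ((le_max_left _ _).trans (le_max_left _ _)).trans (Order.le_succ _),
        (ih.2.2.2.le.trans ((le_max_right _ _).trans (le_max_left _ _))).trans_lt
          (Order.lt_succ _)⟩
  have hlammono : StrictMono lam := strictMono_nat_of_lt_succ fun n => by
    rw [hlamS]
    exact ((le_max_right _ _).trans (le_max_left _ _)).trans_lt (Order.lt_succ _)
  choose D hDZ hDd hDc using fun n => hD (lam n) (hlam n).1
  have hb : ∀ n x, ∃ O : Set X, IsOpen O ∧ (x ∈ D n → O ∩ D n = {x} ∧ count O ≤ ν) := by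
    intro n x
    by_cases hx : x ∈ D n
    · obtain ⟨O, hO, hOD⟩ := hDd n x hx
      obtain ⟨O', hO', hxO', hc⟩ := hZ x (hDZ n hx)
      refine ⟨O ∩ O', hO.inter hO', fun _ => ⟨Subset.antisymm ?_ ?_, ?_⟩⟩
      · rw [← hOD]
        exact fun z hz => ⟨hz.1.1, hz.2⟩
      · intro z hz
        rw [mem_singleton_iff.1 hz]
        have : x ∈ O ∩ D n := by rw [hOD]; exact mem_singleton x
        exact ⟨⟨this.1, hxO'⟩, hx⟩
      · exact (count_mono inter_subset_right).trans hc
    · exact ⟨∅, isOpen_empty, fun h => absurd h hx⟩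
  choose b hbo hb using hb
  have hsmall : ∀ n, ∀ x ∈ D n, ∀ m, #(b n x ∩ D m : Set X) < k := by
    intro n x hx m
    have h1 := two_power_le_count ((hDd m).mono inter_subset_right)
      (inter_subset_left (s := b n x) (t := D m))
    by_contra hc
    have h2 := (h1.trans (hb n x hx).2).trans_lt hντ
    exact absurd h2 (power_le_power_left two_ne_zero (hτk.le.trans (not_lt.1 hc))).not_gt
  -- This keeps later points out of earlier neighbourhoods; fewer than `lam m` points are lost.
  let D' : ℕ → Set X := fun m => {y | y ∈ D m ∧ ∀ n < m, ∀ x ∈ D n, y ∉ b n x}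
  have hD' : ∀ m, lam m ≤ #(D' m) := by
    intro m
    by_contra hc
    have hreg := (hlam m).2.1
    let U : ℕ → Set X := fun n => ⋃ x : D n, b n x ∩ D m
    have hU : ∀ n < m, #(U n) < lam m := by
      intro n hn
      refine mk_iUnion_le_sum_mk.trans_lt ?_
      refine sum_lt_of_isRegular hreg ((hDc n).trans_lt (hlammono hn)) fun x => ?_
      exact (hsmall n x x.2 m).trans (hlam m).2.2.2
    have hsub : D m ⊆ D' m ∪ {x | ∃ n < m, x ∈ U n} := by
      intro y hy
      by_cases h : ∃ n < m, ∃ x ∈ D n, y ∈ b n x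
      · obtain ⟨n, hn, x, hx, hyx⟩ := h
        exact Or.inr ⟨n, hn, mem_iUnion.2 ⟨⟨x, hx⟩, hyx, hy⟩⟩
      · push Not at h
        exact Or.inl ⟨hy, h⟩
    have h1 := (mk_le_mk_of_subset hsub).trans_lt ((mk_union_le _ _).trans_lt
      (add_lt_of_lt hreg.aleph0_le (not_le.1 hc) (mk_setOf_exists_lt hreg.aleph0_le U m hU)))
    exact absurd h1 (hDc m).ge.not_gt
  let I := k.ord.ToType
  have hI : #I = k := mk_ord_toType k
  have hbound : ∀ (p : ℕ → X → I) (m : ℕ), ∀ y ∈ D m, ∃ γ : I, ∀ n < m,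
      ∀ x ∈ b m y ∩ D n, p n x < γ := by
    intro p m y hy
    have h1 := mk_setOf_exists_lt hωk.le (fun n => p n '' (b m y ∩ D n)) m
      fun n _ => mk_image_le.trans_lt (hsmall m y hy n)
    rw [← hk.cof_ord] at h1
    obtain ⟨γ, hγ⟩ := exists_forall_lt_of_mk_lt_cof h1 Subtype.val
    exact ⟨γ, fun n hn x hx => hγ ⟨p n x, n, hn, x, hx, rfl⟩⟩
  have hIne : Nonempty I := by
    rw [← mk_ne_zero_iff, hI]
    exact (aleph0_pos.trans hωk).ne'
  -- Colours keep earlier points out of later neighbourhoods: each level is coloured so that every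
  -- colour occurs `lam m` times on points y for which all earlier points in `b m y` have colours
  -- below a common `γ m`.
  obtain ⟨p, hp⟩ := exists_wf_rec (ι := ℕ) (α := X → I)
    (fun m h p => ∃ γ : I, ∀ i : I,
      lam m ≤ #{y | (y ∈ D' m ∧ ∀ n < m, ∀ x ∈ b m y ∩ D n, h n x < γ) ∧ p y = i})
    (by
      rintro m h h' p hh ⟨γ, hγ⟩
      refine ⟨γ, fun i => (hγ i).trans (mk_le_mk_of_subset ?_)⟩
      rintro y ⟨⟨h1, h2⟩, h3⟩
      exact ⟨⟨h1, fun n hn => hh n hn ▸ h2 n hn⟩, h3⟩) (by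
      intro m h _
      choose! β hβ using hbound h m
      obtain ⟨γ, hγ⟩ := infinite_pigeonhole_card (fun y : D' m => β y) (lam m) (hD' m)
        (hlam m).2.1.aleph0_le (by rw [(hlam m).2.1.cof_ord, hI]; exact (hlam m).2.2.2)
      let F : Set X := {y | y ∈ D' m ∧ ∀ n < m, ∀ x ∈ b m y ∩ D n, h n x < γ}
      have hF1 : lam m ≤ #F := by
        refine hγ.trans (mk_le_of_injective (f := fun y => ⟨y.1.1, y.1.2, ?_⟩) ?_)
        · have h2 := hβ y.1.1 y.1.2.1
          rwa [show β y.1.1 = γ from y.2] at h2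
        · intro y y' e
          have h2 := congrArg Subtype.val e
          exact Subtype.ext (Subtype.ext h2)
      have hF2 : #F = lam m :=
        le_antisymm ((mk_le_mk_of_subset fun y hy => hy.1.1).trans (hDc m).le) hF1
      have hF3 : #F = #(F × I) := by
        rw [mk_prod, lift_id, lift_id, hF2, hI,
          mul_eq_left (hlam m).2.1.aleph0_le (hlam m).2.2.2.le (aleph0_pos.trans hωk).ne']
      obtain ⟨e⟩ := Cardinal.eq.1 hF3
      refine ⟨fun y => if hy : y ∈ F then (e ⟨y, hy⟩).2 else Classical.arbitrary I, γ,
        fun i => ?_⟩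
      refine hF1.trans (mk_le_of_injective (f := fun z => ⟨(e.symm (z, i)).1,
        (e.symm (z, i)).2, ?_⟩) ?_)
      · simp
      · intro z z' h1
        have h3 := congrArg Subtype.val h1
        have h2 : e.symm (z, i) = e.symm (z', i) := Subtype.ext h3
        exact congrArg Prod.fst (e.symm.injective h2))
  choose γ hγ using hp
  -- Keeping only the points of a colour δ above every `γ m` excludes the earlier points from all
  -- the chosen neighbourhoods.
  obtain ⟨δ, hδ⟩ := exists_forall_lt_of_mk_lt_cof (W := k) (T := ULift.{u} ℕ)
    (by rw [hk.cof_ord]; simpa using hωk) (fun n => γ n.down)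
  let E : ℕ → Set X := fun m =>
    {y | (y ∈ D' m ∧ ∀ n < m, ∀ x ∈ b m y ∩ D n, p n x < γ m) ∧ p m y = δ}
  have hE : Disc (⋃ m, E m) := by
    intro y hy
    obtain ⟨m, hm⟩ := mem_iUnion.1 hy
    have hbm := (hb m y hm.1.1.1).1
    have hyb : y ∈ b m y ∩ D m := by rw [hbm]; exact mem_singleton y
    refine ⟨b m y, hbo m y, Subset.antisymm ?_ ?_⟩
    · rintro x ⟨hxb, hxE⟩
      obtain ⟨n, hn⟩ := mem_iUnion.1 hxE
      rcases lt_trichotomy n m with h | rfl | h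
      · have h1 := (hm.1.2 n h x ⟨hxb, hn.1.1.1⟩).trans (hδ ⟨m⟩)
        rw [hn.2] at h1
        exact absurd h1 (lt_irrefl _)
      · rw [← hbm]
        exact ⟨hxb, hn.1.1.1⟩
      · exact absurd hxb (hn.1.1.2 m h y hm.1.1.1)
    · intro x hx
      rw [mem_singleton_iff.1 hx]
      exact ⟨hyb.1, hy⟩
  have hEc : ρ ≤ #(⋃ m, E m) := by
    by_contra hc
    obtain ⟨c, hc'⟩ := hgc _ (hsucc _ (not_le.1 hc))
    have h1 : gn (e c).down ≤ #(⋃ m, E m) := (hlam _).2.2.1.trans ((hγ _ δ).trans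
      (mk_le_mk_of_subset (subset_iUnion E (e c).down)))
    have h2 : gn (e c).down = g c := congrArg g (e.symm_apply_apply c)
    rw [h2] at h1
    exact absurd (((le_max_left _ _).trans_lt (Order.lt_succ _)).trans_le (hc'.trans h1))
      (lt_irrefl _)
  have h1 := (power_le_power_left two_ne_zero hEc).trans (two_power_le_count hE (subset_univ _))
  exact absurd (hg.power_lt hρω.le h1) hρ.not_gt

variable [CompactSpace X] [T2Space X] [TotallyDisconnectedSpace X]

theorem exists_countBound [Nonempty X] (hg : PowerGap (count (univ : Set X)) μ) {Z : Set X}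
    {ν : Cardinal.{u}} (hν : ν < μ) (hZ : ∀ x ∈ Z, ∃ O, IsOpen O ∧ x ∈ O ∧ count O ≤ ν)
    (w : Cardinal.{u}) (hw : w < μ) : ∃ e < μ, CountBound Z w e := by
  induction w using WellFoundedLT.induction with
  | ind w ih =>
  by_cases h2 : 2 ^ w < μ
  · exact ⟨_, h2, fun Y _ _ h => count_le_two_power h⟩
  have hwω : ℵ₀ ≤ w := by
    by_contra hc
    exact h2 ((power_lt_aleph0 (natCast_lt_aleph0 (n := 2)) (not_le.1 hc)).trans hg.aleph0_lt)
  let S : Set Cardinal.{u} := {s | μ ≤ w ^ s}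
  have hwS : w ∈ S := (not_lt.1 h2).trans
    (power_le_power_right ((natCast_lt_aleph0 (n := 2)).le.trans hwω))
  let ρ := (wellFounded_lt (α := Cardinal.{u})).min S ⟨w, hwS⟩
  have hρ : μ ≤ w ^ ρ := (wellFounded_lt (α := Cardinal.{u})).min_mem S ⟨w, hwS⟩
  have hlt : ∀ s < ρ, w ^ s < μ := fun s hs => by
    by_contra hc
    exact absurd hs ((wellFounded_lt (α := Cardinal.{u})).min_le (s := S) (not_lt.1 hc)).not_gt
  have hρw : ρ ≤ w := (wellFounded_lt (α := Cardinal.{u})).min_le (s := S) hwS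
  have hρω : ℵ₀ < ρ := by
    by_contra hc
    exact absurd (hg.power_lt_of_power_lt (not_lt.1 hc) hw) hρ.not_gt
  -- ρ is the least exponent for which w ^ ρ reaches μ. If 2 ^ ρ stays below μ, the base is lowered;
  -- otherwise the gap rules out discrete sets of size ρ.
  by_cases h2ρ : 2 ^ ρ < μ
  · obtain ⟨W, hWw, h2W, -, hW, hcof, hcofρ⟩ := hg.exists_least_base hw hρω h2ρ hρ
    refine exists_countBound_of_two_power_lt hg hwω hWw hw hcof
      ((power_le_power_left two_ne_zero hcofρ).trans_lt h2W) hW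
      (fun s hs => hlt s (hs.trans_le hcofρ)) fun w' hw' => ?_
    exact ih w' (hw'.trans_le hWw) ((hw'.trans_le hWw).trans hw)
  push Not at h2ρ
  have hno : ∀ D ⊆ Z, Disc D → #D ≠ ρ := by
    intro D _ hD hDρ
    have h1 := two_power_le_count hD (subset_univ _)
    rw [hDρ] at h1
    exact absurd (hg.power_lt hρω.le h1) h2ρ.not_gt
  rcases eq_or_ne ρ.ord.cof ℵ₀ with hcof | hcof
  · have h := not_forall_exists_disc hg hν hZ hρω hcof h2ρ
    push Not at h
    obtain ⟨τ, hτ, hD⟩ := h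
    -- When ρ has countable cofinality, some smaller size τ of discrete sets is excluded in Z, and ρ
    -- is replaced by a regular uncountable cardinal above τ.
    let ρ' := Order.succ (max τ ℵ₀)
    have hreg : ρ'.IsRegular := isRegular_succ (le_max_right _ _)
    have hle : ρ' ≤ ρ := Order.succ_le_of_lt (max_lt hτ hρω)
    refine exists_countBound_of_no_disc (ρ := ρ') hg hwω ?_ (hle.trans_lt (hρw.trans_lt hw))
      (fun s hs => hlt s (hs.trans_le hle)) ?_ hν hZ
    · rw [hreg.cof_ord]
      exact (le_max_right _ _).trans_lt (Order.lt_succ _)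
    · intro D hDZ hDd hDc
      have h1 : τ ≤ #D := hDc ▸ (le_max_left τ ℵ₀).trans (Order.le_succ _)
      obtain ⟨D', hD', hc⟩ := le_mk_iff_exists_subset.1 h1
      exact hD D' (hD'.trans hDZ) (hDd.mono hD') hc
  · refine exists_countBound_of_no_disc (ρ := ρ) hg hwω (lt_of_le_of_ne ?_ hcof.symm)
      (hρw.trans_lt hw) hlt hno hν hZ
    exact Ordinal.aleph0_le_cof_iff.2 (Ordinal.one_lt_cof_iff.2 (isSuccLimit_ord hρω.le))

/-- The number of closed subsets of an infinite Boolean space is its own `ℵ₀`-th power. -/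
theorem count_univ_power_aleph0 [Infinite X] :
    count (univ : Set X) ^ ℵ₀ = count (univ : Set X) := by
  have hsep : ∀ C : ℕ → Set X, (∀ n, IsClopen (C n)) → (∀ n m, n ≠ m → C n ∩ C m = ∅) →
      prod (fun n : ULift.{u} ℕ => count (C n.down)) ≤ count (univ : Set X) := by
    intro C hC hd
    exact prod_count_le (fun n : ULift.{u} ℕ => C n.down) _ (fun n => (hC n.down).isOpen)
      (fun n => Subset.rfl) fun i j hij => hd _ _ fun h => hij (ULift.ext _ _ h)
  have htwo : 2 ^ ℵ₀ ≤ count (univ : Set X) := by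
    obtain ⟨C, hC, hd, hne⟩ := exists_disjoint_clopen (fun _ => (univ : Set X))
      (fun _ _ => ⟨0, by simp⟩) (fun _ => infinite_univ)
    refine le_trans ?_ (hsep C hC hd)
    have : ∀ n : ULift.{u} ℕ, 2 ≤ count (C n.down) := by
      intro n
      obtain ⟨x, hx, -⟩ := hne n.down
      have h1 : Disc ({x} : Set X) := fun y hy => ⟨univ, isOpen_univ, by
        rw [univ_inter, mem_singleton_iff.1 hy]⟩
      simpa using two_power_le_count h1 (singleton_subset_iff.2 hx)
    calc (2 : Cardinal.{u}) ^ ℵ₀ = prod fun _ : ULift.{u} ℕ => (2 : Cardinal.{u}) := by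
          rw [prod_const']; simp
      _ ≤ _ := prod_le_prod _ _ this
  refine le_antisymm ?_ (self_le_power _ one_le_aleph0)
  by_contra hcon
  obtain ⟨μ, hg⟩ := exists_powerGap htwo (not_le.1 hcon)
  obtain ⟨s, hs, hsc, hsprod⟩ := hg.exists_seq
  let P : Cardinal.{u} → Set X := fun ε => {x | ∀ O, IsOpen O → x ∈ O → ε ≤ count O}
  -- Otherwise disjoint clopen sets meeting the sets `P (s n)` have counts at least `s n`, and their
  -- product exceeds κ.
  have hfin : ∃ ε < μ, (P ε).Finite := by
    by_contra hc
    push Not at hc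
    obtain ⟨C, hC, hd, hne⟩ := exists_disjoint_clopen (fun n => P (s n)) (by
      intro n m
      obtain ⟨k, hk⟩ := hsc _ (max_lt (hs n) (hs m))
      exact ⟨k, fun x hx => ⟨fun O hO hxO => ((le_max_left _ _).trans hk).trans (hx O hO hxO),
        fun O hO hxO => ((le_max_right _ _).trans hk).trans (hx O hO hxO)⟩⟩) (fun n => hc _ (hs n))
    refine absurd (hsprod (fun n => count (C n)) fun n => ?_) (hsep C hC hd).not_gt
    obtain ⟨x, hxC, hxP⟩ := hne n
    exact hxP _ (hC n).isOpen hxC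
  obtain ⟨ν, hν, hfin⟩ := hfin
  let Z := (P ν)ᶜ
  have hZ : ∀ x ∈ Z, ∃ O, IsOpen O ∧ x ∈ O ∧ count O ≤ ν := by
    intro x hx
    have : ∃ O, IsOpen O ∧ x ∈ O ∧ count O < ν := by
      by_contra hc
      push Not at hc
      exact hx hc
    obtain ⟨O, h1, h2, h3⟩ := this
    exact ⟨O, h1, h2, h3.le⟩
  obtain ⟨w, hw, hZw⟩ := networkLT_of_locally_count_le hg hν hZ
  obtain ⟨e, he, hbd⟩ := exists_countBound hg hν hZ w hw
  have h1 := hbd Z Subset.rfl hfin.isClosed.isOpen_compl.isLocallyClosed hZw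
  have h2 : count (P ν) < μ := by
    refine (count_le_two_power (hasNetwork_mk _)).trans_lt (lt_trans ?_ hg.aleph0_lt)
    exact power_lt_aleph0 (natCast_lt_aleph0 (n := 2)) (lt_aleph0_iff_set_finite.2 hfin)
  have h3 := (count_union_le Z (P ν)).trans_lt
    (mul_lt_of_lt hg.aleph0_lt.le (h1.trans_lt he) h2)
  rw [compl_union_self] at h3
  exact absurd h3 hg.le.not_gt

end TraceCount

/-! ### Stone duality, ideals and subalgebras -/

namespace BooleanIdeals

variable (A : Type u) [BooleanAlgebra A]

/-- The set of homomorphisms to `Bool`, as a subspace of the Cantor cube. -/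
def stoneSet : Set (A → Bool) :=
  {f | f ⊥ = false ∧ f ⊤ = true ∧ (∀ a b, f (a ⊔ b) = (f a || f b)) ∧
    ∀ a b, f (a ⊓ b) = (f a && f b)}

theorem isClosed_stoneSet : IsClosed (stoneSet A) := by
  have h : stoneSet A = {f | f ⊥ = false} ∩ {f | f ⊤ = true} ∩
      (⋂ a, ⋂ b, {f | f (a ⊔ b) = (f a || f b)}) ∩ ⋂ a, ⋂ b, {f | f (a ⊓ b) = (f a && f b)} := by
    ext f
    simp [stoneSet, and_assoc]
  have hor : ∀ a b : A, Continuous fun f : A → Bool => (f a || f b) := fun a b =>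
    (continuous_of_discreteTopology (f := fun p : Bool × Bool => (p.1 || p.2))).comp
      ((continuous_apply (A := fun _ : A => Bool) a).prodMk (continuous_apply b))
  have hand : ∀ a b : A, Continuous fun f : A → Bool => (f a && f b) := fun a b =>
    (continuous_of_discreteTopology (f := fun p : Bool × Bool => (p.1 && p.2))).comp
      ((continuous_apply (A := fun _ : A => Bool) a).prodMk (continuous_apply b))
  rw [h]
  refine (((isClosed_eq (continuous_apply _) continuous_const).inter
    (isClosed_eq (continuous_apply _) continuous_const)).inter
    (isClosed_iInter fun a => isClosed_iInter fun b => isClosed_eq (continuous_apply _) ?_)).inter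
    (isClosed_iInter fun a => isClosed_iInter fun b => isClosed_eq (continuous_apply _) ?_)
  · exact hor a b
  · exact hand a b

/-- The Stone space. -/
abbrev Stone : Type u := stoneSet A

instance : CompactSpace (Stone A) := isCompact_iff_compactSpace.1 (isClosed_stoneSet A).isCompact

variable {A}

/-- The basic clopen set of an element. -/
def basic (a : A) : Set (Stone A) := {f | f.1 a = true}

theorem isOpen_basic (a : A) : IsOpen (basic a) := by
  have : basic a = (fun f : Stone A => f.1 a) ⁻¹' {true} := rfl
  rw [this]
  exact (isOpen_discrete _).preimage ((continuous_apply a).comp continuous_subtype_val)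

theorem Stone.mono (f : Stone A) {a b : A} (h : a ≤ b) (ha : f.1 a = true) : f.1 b = true := by
  have := f.2.2.2.1 a b
  rw [sup_eq_right.2 h, ha] at this
  simpa using this

theorem Stone.map_compl (f : Stone A) (a : A) : f.1 aᶜ = !f.1 a := by
  have h1 := f.2.2.2.1 a aᶜ
  have h2 := f.2.2.2.2 a aᶜ
  rw [sup_compl_eq_top, f.2.2.1] at h1
  rw [inf_compl_eq_bot, f.2.1] at h2
  revert h1 h2
  cases f.1 a <;> cases f.1 aᶜ <;> simp

theorem exists_stone_of_notMem (I : Order.Ideal A) {a : A} (ha : a ∉ I) :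
    ∃ f : Stone A, f.1 a = true ∧ ∀ b ∈ I, f.1 b = false := by
  classical
  have hd : Disjoint (Order.PFilter.principal a : Set A) (I : Set A) := by
    rw [Set.disjoint_left]
    intro x hx hxI
    exact ha (I.lower (Order.PFilter.mem_principal.1 hx) hxI)
  obtain ⟨J, hJ, hIJ, hdJ⟩ := DistribLattice.prime_ideal_of_disjoint_filter_ideal hd
  have haJ : a ∉ J := fun h =>
    Set.disjoint_left.1 hdJ (Order.PFilter.mem_principal.2 le_rfl : a ∈ Order.PFilter.principal a) h
  refine ⟨⟨fun x => decide (x ∉ J), ?_, ?_, ?_, ?_⟩, by simpa using haJ, fun b hb => ?_⟩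
  · simp
  · simpa using hJ.toIsProper.top_notMem
  · intro x y
    by_cases hx : x ∈ J <;> by_cases hy : y ∈ J <;> simp [hx, hy, Order.Ideal.sup_mem_iff]
  · intro x y
    have : x ⊓ y ∈ J ↔ x ∈ J ∨ y ∈ J := ⟨hJ.mem_or_mem, fun h => h.elim
      (fun h => J.lower inf_le_left h) (fun h => J.lower inf_le_right h)⟩
    by_cases hx : x ∈ J <;> by_cases hy : y ∈ J <;> simp [hx, hy, this]
  · simpa using hIJ hb

theorem exists_basic_subset {U : Set (Stone A)} (hU : IsOpen U) {f : Stone A} (hf : f ∈ U) :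
    ∃ a : A, f ∈ basic a ∧ basic a ⊆ U := by
  classical
  obtain ⟨V, hV, rfl⟩ := isOpen_induced_iff.1 hU
  obtain ⟨s, u, hu, hsub⟩ := isOpen_pi_iff.1 hV f.1 hf
  have key : ∀ t : Finset A, ∃ a : A, f.1 a = true ∧
      ∀ g : Stone A, g.1 a = true → ∀ b ∈ t, g.1 b = f.1 b := by
    intro t
    induction t using Finset.induction_on with
    | empty => exact ⟨⊤, f.2.2.1, by simp⟩
    | insert b t _ ih =>
      obtain ⟨a, ha, hag⟩ := ih
      refine ⟨a ⊓ (if f.1 b = true then b else bᶜ), ?_, fun g hg c hc => ?_⟩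
      · rw [f.2.2.2.2, ha]
        by_cases hb : f.1 b = true
        · simp [hb]
        · simp [hb, f.map_compl]
      · rw [g.2.2.2.2, Bool.and_eq_true] at hg
        rcases Finset.mem_insert.1 hc with rfl | hc
        · have h2 := hg.2
          by_cases hb : f.1 c = true
          · rw [if_pos hb] at h2
            rw [h2, hb]
          · rw [if_neg hb, g.map_compl] at h2
            rw [Bool.not_eq_true] at hb
            rw [hb]
            simpa using h2
        · exact hag g hg.1 c hc
  obtain ⟨a, ha, hag⟩ := key s
  refine ⟨a, ha, fun g hg => hsub ?_⟩
  intro b hb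
  rw [hag g hg b hb]
  exact (hu b hb).2

instance [Infinite A] : Infinite (Stone A) := by
  have hinj : Function.Injective (basic : A → Set (Stone A)) := by
    have key : ∀ a b : A, basic a ⊆ basic b → a ≤ b := by
      intro a b h
      by_contra hab
      obtain ⟨f, hfa, hfb⟩ := exists_stone_of_notMem (Order.Ideal.principal b) (a := a)
        (by simpa using hab)
      have h1 := hfb b (by simp)
      have h2 : f.1 b = true := h hfa
      rw [h1] at h2
      exact Bool.false_ne_true h2
    intro a b h
    exact le_antisymm (key a b h.le) (key b a h.ge)
  by_contra hfin
  rw [not_infinite_iff_finite] at hfin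
  exact not_finite_iff_infinite.2 ‹Infinite A› (Finite.of_injective _ hinj)

/-- Ideals correspond to open sets of the Stone space: prime ideals separate points from ideals, and
the basic sets form a base. -/
theorem mk_ideal_eq_count : #(Order.Ideal A) = TraceCount.count (univ : Set (Stone A)) := by
  refine le_antisymm ?_ ?_
  · refine mk_le_of_injective (f := fun I => (⟨(⋃ a ∈ I, basic a)ᶜ, (⋃ a ∈ I, basic a)ᶜ,
      (isOpen_biUnion fun a _ => isOpen_basic a).isClosed_compl, (inter_univ _).symm⟩ :
      TraceCount.traces (univ : Set (Stone A)))) ?_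
    have key : ∀ I J : Order.Ideal A, (⋃ a ∈ I, basic a) = ⋃ a ∈ J, basic a → I ≤ J := by
      intro I J h a ha
      by_contra haJ
      obtain ⟨f, hfa, hfJ⟩ := exists_stone_of_notMem J haJ
      have h1 : f ∈ ⋃ a ∈ I, basic a := mem_iUnion₂.2 ⟨a, ha, hfa⟩
      rw [h] at h1
      obtain ⟨b, hb, hfb⟩ := mem_iUnion₂.1 h1
      exact Bool.false_ne_true ((hfJ b hb).symm.trans hfb)
    intro I J e
    have h := compl_injective (congrArg Subtype.val e)
    exact le_antisymm (key I J h) (key J I h.symm)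
  · let ideal : Set (Stone A) → Order.Ideal A := fun F =>
      { carrier := {a | basic a ∩ F = ∅}
        lower' := by
          intro a b hba ha
          refine eq_empty_of_forall_notMem fun f hf => ?_
          have : f ∈ basic a ∩ F := ⟨f.mono hba hf.1, hf.2⟩
          rw [show basic a ∩ F = ∅ from ha] at this
          exact this
        nonempty' := ⟨⊥, eq_empty_of_forall_notMem fun f hf =>
          Bool.false_ne_true (f.2.1.symm.trans hf.1)⟩
        directed' := by
          intro a ha b hb
          refine ⟨a ⊔ b, ?_, le_sup_left, le_sup_right⟩
          refine eq_empty_of_forall_notMem fun f hf => ?_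
          have h1 : f.1 (a ⊔ b) = true := hf.1
          rw [f.2.2.2.1, Bool.or_eq_true] at h1
          rcases h1 with h | h
          · have : f ∈ basic a ∩ F := ⟨h, hf.2⟩
            rw [show basic a ∩ F = ∅ from ha] at this
            exact this
          · have : f ∈ basic b ∩ F := ⟨h, hf.2⟩
            rw [show basic b ∩ F = ∅ from hb] at this
            exact this }
    refine mk_le_of_injective
      (f := fun F : TraceCount.traces (univ : Set (Stone A)) => ideal F.1) ?_
    have key : ∀ F G : Set (Stone A), IsClosed F → ideal F = ideal G → G ⊆ F := by
      intro F G hF h f hf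
      by_contra hfF
      obtain ⟨a, hfa, haF⟩ := exists_basic_subset hF.isOpen_compl hfF
      have h1 : a ∈ ideal F := eq_empty_of_forall_notMem fun g hg => haF hg.1 hg.2
      rw [h] at h1
      have h2 : f ∈ basic a ∩ G := ⟨hfa, hf⟩
      rw [show basic a ∩ G = ∅ from h1] at h2
      exact h2
    rintro ⟨F, F', hF, rfl⟩ ⟨G, G', hG, rfl⟩ e
    simp only [inter_univ] at e ⊢
    exact Subtype.ext (Subset.antisymm (key _ _ hG e.symm) (key _ _ hF e))

variable (A) in
theorem mk_ideal_power_aleph0 [Infinite A] : #(Order.Ideal A) ^ ℵ₀ = #(Order.Ideal A) := by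
  rw [mk_ideal_eq_count, TraceCount.count_univ_power_aleph0]

variable (A) in
theorem mk_le_mk_ideal : #A ≤ #(Order.Ideal A) :=
  mk_le_of_injective (f := Order.Ideal.principal) fun a b h => by
    have h1 : a ∈ Order.Ideal.principal b := h ▸ Order.Ideal.mem_principal.2 le_rfl
    have h2 : b ∈ Order.Ideal.principal a := h ▸ Order.Ideal.mem_principal.2 le_rfl
    exact le_antisymm (Order.Ideal.mem_principal.1 h1) (Order.Ideal.mem_principal.1 h2)

/-- Maximal proper ideals. -/
def IsUltra (I : Order.Ideal A) : Prop := ⊤ ∉ I ∧ ∀ x, x ∈ I ∨ xᶜ ∈ I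

theorem IsUltra.compl_mem_iff {I : Order.Ideal A} (h : IsUltra I) (x : A) : xᶜ ∈ I ↔ x ∉ I := by
  refine ⟨fun h1 h2 => h.1 ?_, fun h1 => (h.2 x).resolve_left h1⟩
  rw [← sup_compl_eq_top (x := x)]
  exact I.sup_mem h2 h1

theorem IsUltra.inf_mem_iff {I : Order.Ideal A} (h : IsUltra I) (x y : A) :
    x ⊓ y ∈ I ↔ x ∈ I ∨ y ∈ I := by
  refine ⟨fun h1 => ?_, fun h => h.elim
      (fun h => I.lower inf_le_left h) (fun h => I.lower inf_le_right h)⟩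
  by_contra hc
  push Not at hc
  have h2 := I.sup_mem h1 (I.sup_mem ((h.compl_mem_iff x).2 hc.1) ((h.compl_mem_iff y).2 hc.2))
  rw [← compl_inf, sup_compl_eq_top] at h2
  exact h.1 h2

/-- The subalgebra generated by an ideal. -/
def ofIdeal (I : Order.Ideal A) : BooleanSubalgebra A where
  carrier := {x | x ∈ I ∨ xᶜ ∈ I}
  supClosed' := by
    rintro x hx y hy
    by_cases h : x ∈ I ∧ y ∈ I
    · exact Or.inl (I.sup_mem h.1 h.2)
    · refine Or.inr ?_
      rw [compl_sup]
      by_cases hxI : x ∈ I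
      · exact I.lower inf_le_right (hy.resolve_left fun hyI => h ⟨hxI, hyI⟩)
      · exact I.lower inf_le_left (hx.resolve_left hxI)
  infClosed' := by
    rintro x hx y hy
    by_cases h : x ∈ I ∨ y ∈ I
    · exact Or.inl (h.elim (fun h => I.lower inf_le_left h) (fun h => I.lower inf_le_right h))
    · push Not at h
      refine Or.inr ?_
      rw [compl_inf]
      exact I.sup_mem (hx.resolve_left h.1) (hy.resolve_left h.2)
  compl_mem' := by
    rintro x (h | h)
    · exact Or.inr (by rwa [compl_compl])
    · exact Or.inl h
  bot_mem' := Or.inl I.bot_mem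

/-- The subalgebra of elements on which two maximal ideals agree. -/
def ofUltra {I J : Order.Ideal A} (hI : IsUltra I) (hJ : IsUltra J) : BooleanSubalgebra A where
  carrier := {x | x ∈ I ↔ x ∈ J}
  supClosed' := by
    intro x hx y hy
    change _ ↔ _
    rw [Order.Ideal.sup_mem_iff, Order.Ideal.sup_mem_iff]
    exact and_congr hx hy
  infClosed' := by
    intro x hx y hy
    change _ ↔ _
    rw [hI.inf_mem_iff, hJ.inf_mem_iff]
    exact or_congr hx hy
  compl_mem' := by
    intro x hx
    change _ ↔ _
    rw [hI.compl_mem_iff, hJ.compl_mem_iff]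
    exact not_congr hx
  bot_mem' := iff_of_true I.bot_mem J.bot_mem

variable (A) in
-- A maximal ideal generates all of `A`, so maximal ideals are coded separately, by where they agree
-- with a fixed one; all other ideals are determined by the subalgebra they generate. The resulting
-- factor 2 is absorbed.
theorem mk_ideal_le_sub [Infinite A] : #(Order.Ideal A) ≤ BAlg.sub A := by
  have h1 : #{I : Order.Ideal A // IsUltra I} ≤ BAlg.sub A := by
    by_cases h : Nonempty {I : Order.Ideal A // IsUltra I}
    · obtain ⟨I, hI⟩ := h
      refine mk_le_of_injective (f := fun J => ofUltra hI J.2) ?_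
      have key : ∀ J : {I : Order.Ideal A // IsUltra I}, ∀ x, x ∈ J.1 ↔ (x ∈ I ↔
          x ∈ ofUltra hI J.2) := by
        intro J x
        change _ ↔ (_ ↔ (_ ↔ _))
        tauto
      intro J J' e
      refine Subtype.ext (Order.Ideal.ext (Set.ext fun x => ?_))
      refine (key J x).trans (Iff.trans ?_ (key J' x).symm)
      rw [show ofUltra hI J.2 = ofUltra hI J'.2 from e]
    · rw [not_nonempty_iff] at h
      simp
  have h2 : #{I : Order.Ideal A // ¬ IsUltra I} ≤ BAlg.sub A := by
    refine mk_le_of_injective (f := fun J => ofIdeal J.1) ?_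
    have key : ∀ I J : Order.Ideal A, ¬ IsUltra J → ofIdeal I = ofIdeal J → I ≤ J := by
      intro I J hJ e x hx
      by_contra hxJ
      have hmem : ∀ y, y ∈ I → y ∈ J ∨ yᶜ ∈ J := by
        intro y hy
        have : y ∈ ofIdeal I := Or.inl hy
        rw [e] at this
        exact this
      have hxc : xᶜ ∈ J := (hmem x hx).resolve_left hxJ
      refine hJ ⟨fun h => hxJ (J.lower le_top h), fun z => ?_⟩
      rcases hmem (z ⊓ x) (I.lower inf_le_right hx) with h | h
      · refine Or.inl ?_
        rw [show z = z ⊓ x ⊔ z ⊓ xᶜ by rw [← inf_sup_left, sup_compl_eq_top, inf_top_eq]]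
        exact J.sup_mem h (J.lower inf_le_right hxc)
      · refine Or.inr (J.lower ?_ h)
        exact compl_anti inf_le_left
    intro I J e
    exact Subtype.ext (le_antisymm (key _ _ J.2 e) (key _ _ I.2 e.symm))
  have h3 : #(Order.Ideal A) ≤ BAlg.sub A + BAlg.sub A := by
    rw [← mk_sum_compl {I : Order.Ideal A | IsUltra I}]
    exact add_le_add h1 h2
  have h4 : ℵ₀ ≤ #(Order.Ideal A) := (aleph0_le_mk A).trans (mk_le_mk_ideal A)
  have h5 : ℵ₀ ≤ BAlg.sub A := by
    by_contra hc
    exact absurd (h4.trans h3) (add_lt_aleph0 (not_le.1 hc) (not_le.1 hc)).not_ge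
  rwa [add_eq_self h5] at h3

/-- The choice g is recovered from the ideal it generates: by disjointness, `g i` is the largest
element of the ideal below `a i`. -/
theorem prod_mk_Iic_le_mk_ideal {ι : Type u} (a : ι → A)
    (ha : ∀ i j, i ≠ j → Disjoint (a i) (a j)) :
    (prod fun i => #(Iic (a i))) ≤ #(Order.Ideal A) := by
  classical
  rw [← mk_pi]
  let ideal : (∀ i, Iic (a i)) → Order.Ideal A := fun g =>
    { carrier := {x | ∃ s : Finset ι, x ≤ s.sup fun i => (g i : A)}
      lower' := by
        rintro x y hyx ⟨s, hs⟩
        exact ⟨s, hyx.trans hs⟩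
      nonempty' := ⟨⊥, ∅, bot_le⟩
      directed' := by
        rintro x ⟨s, hs⟩ y ⟨t, ht⟩
        refine ⟨x ⊔ y, ⟨s ∪ t, ?_⟩, le_sup_left, le_sup_right⟩
        rw [Finset.sup_union]
        exact sup_le_sup hs ht }
  refine mk_le_of_injective (f := ideal) ?_
  have key : ∀ g g' i, ideal g = ideal g' → (g i : A) ≤ g' i := by
    intro g g' i e
    have h1 : (g i : A) ∈ ideal g := ⟨{i}, by simp⟩
    rw [e] at h1
    obtain ⟨s, hs⟩ := h1
    rw [← inf_eq_left.2 hs, Finset.sup_inf_distrib_left]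
    refine Finset.sup_le fun j _ => ?_
    by_cases hij : i = j
    · subst hij; exact inf_le_right
    · have h2 : (g i : A) ⊓ g' j ≤ a i ⊓ a j := inf_le_inf (g i).2 (g' j).2
      rw [(ha i j hij).eq_bot] at h2
      exact h2.trans bot_le
  intro g g' e
  funext i
  exact Subtype.ext (le_antisymm (key g g' i e) (key g' g i e.symm))

theorem two_power_le_mk_ideal {E : Set A} (hE : ∀ x ∈ E, x ≠ ⊥)
    (hd : ∀ x ∈ E, ∀ y ∈ E, x ≠ y → Disjoint x y) : 2 ^ #E ≤ #(Order.Ideal A) := by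
  refine le_trans ?_ (prod_mk_Iic_le_mk_ideal (fun e : E => (e : A)) fun i j hij =>
    hd _ i.2 _ j.2 fun h => hij (Subtype.ext h))
  rw [← prod_const']
  refine prod_le_prod _ _ fun e => ?_
  rw [two_le_iff]
  exact ⟨⟨⊥, mem_Iic.2 bot_le⟩, ⟨e, mem_Iic.2 le_rfl⟩, fun h =>
    hE e e.2 (congrArg Subtype.val h).symm⟩

end BooleanIdeals

/-! ### Relative subalgebras and relative automorphisms -/

namespace RelAut

variable {A : Type u} [BooleanAlgebra A]

/-- The subalgebras of the relative algebra `Iic u`. -/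
def RelSub (u : A) : Set (Set A) :=
  {S | (∀ x ∈ S, x ≤ u) ∧ ⊥ ∈ S ∧ (∀ x ∈ S, ∀ y ∈ S, x ⊔ y ∈ S) ∧ ∀ x ∈ S, u \ x ∈ S}

/-- The subalgebra glued from relative subalgebras. -/
def glue {ι : Type u} (u : ι → A) (S : ∀ i, RelSub (u i)) : BooleanSubalgebra A :=
  have hsup : ∀ x y : A, (∀ i, x ⊓ u i ∈ (S i).1) → (∀ i, y ⊓ u i ∈ (S i).1) →
      ∀ i, (x ⊔ y) ⊓ u i ∈ (S i).1 := fun x y hx hy i => by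
    rw [inf_sup_right]
    exact (S i).2.2.2.1 _ (hx i) _ (hy i)
  have hcompl : ∀ x : A, (∀ i, x ⊓ u i ∈ (S i).1) → ∀ i, xᶜ ⊓ u i ∈ (S i).1 := fun x hx i => by
    have := (S i).2.2.2.2 _ (hx i)
    rwa [_root_.sdiff_eq, compl_inf, inf_sup_left, inf_compl_self, sup_bot_eq, inf_comm] at this
  { carrier := {x | ∀ i, x ⊓ u i ∈ (S i).1}
    supClosed' := fun x hx y hy => hsup x y hx hy
    infClosed' := fun x hx y hy => by
      have := hcompl _ (hsup _ _ (hcompl x hx) (hcompl y hy))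
      rwa [compl_sup, compl_compl, compl_compl] at this
    compl_mem' := fun {x} hx => hcompl x hx
    bot_mem' := fun i => by
      rw [bot_inf_eq]
      exact (S i).2.2.1 }

theorem prod_mk_relSub_le {ι : Type u} (u : ι → A) (hu : ∀ i j, i ≠ j → Disjoint (u i) (u j)) :
    (prod fun i => #(RelSub (u i))) ≤ BAlg.sub A := by
  rw [← mk_pi]
  refine mk_le_of_injective (f := glue u) ?_
  have key : ∀ (S : ∀ i, RelSub (u i)) i x, x ∈ (S i).1 ↔ x ≤ u i ∧ x ∈ glue u S := by
    intro S i x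
    constructor
    · intro hx
      have hxu := (S i).2.1 x hx
      refine ⟨hxu, fun j => ?_⟩
      by_cases hij : i = j
      · subst hij
        rwa [inf_eq_left.2 hxu]
      · rw [((hu i j hij).mono_left hxu).eq_bot]
        exact (S j).2.2.1
    · rintro ⟨hxu, hx⟩
      have := hx i
      rwa [inf_eq_left.2 hxu] at this
  intro S S' e
  funext i
  refine Subtype.ext (Set.ext fun x => ?_)
  rw [key S, key S', e]

/-- The number of automorphisms of the relative algebra `Iic a`. -/
def autCard (a : A) : Cardinal.{u} := #(Iic a ≃o Iic a)

theorem mk_orderIso_le (a b : A) : #(Iic a ≃o Iic b) ≤ autCard a := by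
  by_cases h : Nonempty (Iic a ≃o Iic b)
  · obtain ⟨φ⟩ := h
    refine mk_le_of_injective (f := fun ψ => ψ.trans φ.symm) ?_
    intro ψ ψ' e
    ext x
    have := congrArg (fun χ : Iic a ≃o Iic a => φ (χ x)) e
    simp only [OrderIso.trans_apply, OrderIso.apply_symm_apply] at this
    rw [this]
  · rw [not_nonempty_iff] at h
    rw [mk_eq_zero]
    exact zero_le

theorem autCard_le {a b : A} (φ : Iic a ≃o Iic b) : autCard a ≤ #(Iic a ≃o Iic b) :=
  mk_le_of_injective (f := fun ψ : Iic a ≃o Iic a => ψ.trans φ) fun ψ ψ' e => by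
    ext x
    have := congrArg (fun χ : Iic a ≃o Iic b => φ.symm (χ x)) e
    simp only [OrderIso.trans_apply, OrderIso.symm_apply_apply] at this
    rw [this]

theorem exists_extend {a b : A} (hab : a ≤ b) (φ : Iic a ≃o Iic a) :
    ∃ ψ : Iic b ≃o Iic b, ∀ x : Iic a, (ψ ⟨x, x.2.trans hab⟩ : A) = φ x := by
  let ext : (Iic a ≃o Iic a) → Iic b → Iic b := fun φ x =>
    ⟨φ ⟨x.1 ⊓ a, inf_le_right⟩ ⊔ x.1 \ a, sup_le ((φ _).2.trans hab) (sdiff_le.trans x.2)⟩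
  have hmono : ∀ φ, Monotone (ext φ) := by
    intro φ x y hxy
    refine sup_le_sup ?_ (sdiff_le_sdiff_right hxy)
    exact φ.monotone (show (⟨x.1 ⊓ a, _⟩ : Iic a) ≤ ⟨y.1 ⊓ a, _⟩ from inf_le_inf_right a hxy)
  have hinv : ∀ φ x, ext φ.symm (ext φ x) = x := by
    intro φ x
    refine Subtype.ext ?_
    have h0 : ((φ ⟨x.1 ⊓ a, inf_le_right⟩ : Iic a) : A) ≤ a := (φ _).2
    have h1 : (ext φ x : A) ⊓ a = φ ⟨x.1 ⊓ a, inf_le_right⟩ := by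
      change (_ ⊔ _) ⊓ a = _
      rw [inf_sup_right, inf_eq_left.2 h0, disjoint_sdiff_self_left.eq_bot, sup_bot_eq]
    have h2 : (ext φ x : A) \ a = x.1 \ a := by
      change (_ ⊔ _) \ a = _
      rw [sup_sdiff, sdiff_eq_bot_iff.2 h0, bot_sup_eq, sdiff_idem]
    have h3 : (⟨(ext φ x : A) ⊓ a, inf_le_right⟩ : Iic a) = φ ⟨x.1 ⊓ a, inf_le_right⟩ :=
      Subtype.ext h1
    change (φ.symm ⟨(ext φ x : A) ⊓ a, inf_le_right⟩ : A) ⊔ (ext φ x : A) \ a = x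
    rw [h3, h2, OrderIso.symm_apply_apply, sup_inf_sdiff]
  refine ⟨Equiv.toOrderIso ⟨ext φ, ext φ.symm, hinv φ, fun x => ?_⟩ (hmono _) (hmono _), ?_⟩
  · have := hinv φ.symm x
    rwa [OrderIso.symm_symm] at this
  · intro x
    change (φ ⟨x.1 ⊓ a, inf_le_right⟩ : A) ⊔ x.1 \ a = φ x
    have : (⟨x.1 ⊓ a, inf_le_right⟩ : Iic a) = x := Subtype.ext (inf_eq_left.2 x.2)
    rw [this, sdiff_eq_bot_iff.2 x.2, sup_bot_eq]

theorem autCard_mono {a b : A} (hab : a ≤ b) : autCard a ≤ autCard b := by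
  choose ψ hψ using exists_extend hab
  refine mk_le_of_injective (f := ψ) fun φ φ' e => ?_
  ext x
  rw [← hψ φ, ← hψ φ', e]

/-- An isomorphism φ is coded by the subalgebra of those z whose part in b is carried by φ to their
part in b'. It is recovered because x ⊔ φ x belongs to the code. -/
theorem mk_orderIso_le_relSub {b b' : A} (hb : Disjoint b b') :
    #(Iic b ≃o Iic b') ≤ #(RelSub (b ⊔ b')) := by
  let code : (Iic b ≃o Iic b') → Set A := fun φ =>
    {z | z ≤ b ⊔ b' ∧ (φ ⟨z ⊓ b, inf_le_right⟩ : A) = z ⊓ b'}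
  have hcode : ∀ φ, code φ ∈ RelSub (b ⊔ b') := by
    intro φ
    refine ⟨fun x hx => hx.1, ⟨bot_le, ?_⟩, ?_, ?_⟩
    · have : (⟨⊥ ⊓ b, inf_le_right⟩ : Iic b) = ⊥ := Subtype.ext (bot_inf_eq _)
      rw [this, map_bot, bot_inf_eq]
      rfl
    · rintro x ⟨hx, hx'⟩ y ⟨hy, hy'⟩
      refine ⟨sup_le hx hy, ?_⟩
      have : (⟨(x ⊔ y) ⊓ b, inf_le_right⟩ : Iic b) =
          ⟨x ⊓ b, inf_le_right⟩ ⊔ ⟨y ⊓ b, inf_le_right⟩ := Subtype.ext (inf_sup_right _ _ _)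
      rw [this, map_sup, Iic.coe_sup, hx', hy', inf_sup_right]
    · rintro x ⟨hx, hx'⟩
      refine ⟨sdiff_le, ?_⟩
      have hinf : ∀ c, x ⊓ c ⊓ ((b ⊔ b') \ x ⊓ c) = ⊥ := fun c => by
        rw [inf_inf_inf_comm, disjoint_sdiff_self_right.eq_bot, bot_inf_eq]
      have hsup : ∀ c ≤ b ⊔ b', x ⊓ c ⊔ ((b ⊔ b') \ x ⊓ c) = c := fun c hc => by
        rw [← inf_sup_right, sup_sdiff_cancel_right hx, inf_eq_right.2 hc]
      have h1 : (⟨x ⊓ b, inf_le_right⟩ : Iic b) ⊓ ⟨(b ⊔ b') \ x ⊓ b, inf_le_right⟩ = ⊥ :=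
        Subtype.ext (hinf b)
      have h2 : (⟨x ⊓ b, inf_le_right⟩ : Iic b) ⊔ ⟨(b ⊔ b') \ x ⊓ b, inf_le_right⟩ = ⊤ :=
        Subtype.ext (hsup b le_sup_left)
      have h1' := congrArg (fun z => (φ z : A)) h1
      have h2' := congrArg (fun z => (φ z : A)) h2
      simp only [map_inf, map_sup, map_bot, map_top, Iic.coe_inf, Iic.coe_sup, hx', Iic.coe_bot,
        Iic.coe_top] at h1' h2'
      refine eq_of_inf_eq_sup_eq (a := x ⊓ b') ?_ ?_
      · rw [inf_comm, h1', inf_comm, hinf]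
      · rw [sup_comm, h2', sup_comm, hsup b' le_sup_right]
  refine mk_le_of_injective (f := fun φ => ⟨code φ, hcode φ⟩) ?_
  intro φ ψ e
  ext x
  have h0 : ((φ x : Iic b') : A) ≤ b' := (φ x).2
  have h1 : ((x : A) ⊔ φ x) ⊓ b = x := by
    rw [inf_sup_right, inf_eq_left.2 x.2, (hb.symm.mono_left h0).eq_bot, sup_bot_eq]
  have h2 : ((x : A) ⊔ φ x) ⊓ b' = φ x := by
    rw [inf_sup_right, inf_eq_left.2 h0, (hb.mono_left x.2).eq_bot, bot_sup_eq]
  have h3 : (⟨((x : A) ⊔ φ x) ⊓ b, inf_le_right⟩ : Iic b) = x := Subtype.ext h1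
  have h4 : (x : A) ⊔ φ x ∈ code φ := ⟨sup_le_sup x.2 h0, by rw [h3, h2]⟩
  rw [show code φ = code ψ from congrArg Subtype.val e] at h4
  have h5 := h4.2
  rw [h3, h2] at h5
  exact h5.symm

/-- If φ does not map x above itself, then y = x \ φ x is nonzero and is disjoint from φ y ≤ φ x. -/
theorem exists_disjoint_of_autCard_ne_one {v : A} (hv : autCard v ≠ 1) :
    ∃ b b', b ≠ ⊥ ∧ b' ≠ ⊥ ∧ b ≤ v ∧ b' ≤ v ∧ Disjoint b b' ∧ Nonempty (Iic b ≃o Iic b') := by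
  have key : ∀ (φ : Iic v ≃o Iic v) (x : Iic v), ¬ x ≤ φ x → ∃ b b', b ≠ ⊥ ∧ b' ≠ ⊥ ∧
      b ≤ v ∧ b' ≤ v ∧ Disjoint b b' ∧ Nonempty (Iic b ≃o Iic b') := by
    intro φ x hx
    let y : Iic v := ⟨x.1 \ φ x, sdiff_le.trans x.2⟩
    have hy : y ≠ ⊥ := fun h => hx (sdiff_eq_bot_iff.1 (congrArg Subtype.val h))
    have hφy : φ y ≠ ⊥ := fun h => hy (by
      rw [← φ.symm_apply_apply y, h, map_bot])
    have hle : (φ y : A) ≤ φ x := φ.monotone (show y ≤ x from sdiff_le (a := x.1))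
    refine ⟨y, φ y, fun h => hy (Subtype.ext h), fun h => hφy (Subtype.ext h), y.2, (φ y).2,
      disjoint_sdiff_self_left.mono_right hle, ⟨⟨⟨fun z => ⟨φ ⟨z, z.2.trans y.2⟩, ?_⟩,
      fun z => ⟨φ.symm ⟨z, z.2.trans (φ y).2⟩, ?_⟩, fun z => ?_, fun z => ?_⟩, ?_⟩⟩⟩
    · exact φ.monotone (show (⟨z, z.2.trans y.2⟩ : Iic v) ≤ y from z.2)
    · have : φ.symm ⟨z, z.2.trans (φ y).2⟩ ≤ φ.symm (φ y) :=
        φ.symm.monotone (show (⟨z, z.2.trans (φ y).2⟩ : Iic v) ≤ φ y from z.2)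
      rw [φ.symm_apply_apply] at this
      exact this
    · have := congrArg Subtype.val (φ.symm_apply_apply ⟨z, z.2.trans y.2⟩)
      exact Subtype.ext this
    · have := congrArg Subtype.val (φ.apply_symm_apply ⟨z, z.2.trans (φ y).2⟩)
      exact Subtype.ext this
    · intro z w
      exact φ.le_iff_le (x := ⟨z, z.2.trans y.2⟩) (y := ⟨w, w.2.trans y.2⟩)
  have hne : ∃ φ : Iic v ≃o Iic v, ∃ x, φ x ≠ x := by
    by_contra hc
    push Not at hc
    refine hv (Cardinal.eq_one_iff_unique.2 ⟨⟨fun φ ψ => ?_⟩, ⟨OrderIso.refl _⟩⟩)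
    ext x
    rw [hc φ x, hc ψ x]
  obtain ⟨φ, x, hx⟩ := hne
  by_cases h : x ≤ φ x
  · refine key φ.symm (φ x) fun h' => hx (le_antisymm ?_ h)
    rwa [φ.symm_apply_apply] at h'
  · exact key φ x h

/-! ### Homogeneous elements and cellular families -/

/-- `F` is constant on the nonzero elements below `c`. -/
def IsHomog (F : A → Cardinal.{u}) (c : A) : Prop := ∀ b ≤ c, b ≠ ⊥ → F b = F c

theorem exists_isHomog {F : A → Cardinal.{u}} (hF : Monotone F) {a : A} (ha : a ≠ ⊥) :
    ∃ b ≤ a, b ≠ ⊥ ∧ IsHomog F b := by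
  let S : Set Cardinal.{u} := F '' {b | b ≤ a ∧ b ≠ ⊥}
  have hS : S.Nonempty := ⟨_, a, ⟨le_rfl, ha⟩, rfl⟩
  obtain ⟨b, ⟨hba, hb⟩, hbF⟩ := (wellFounded_lt (α := Cardinal.{u})).min_mem S hS
  refine ⟨b, hba, hb, fun d hdb hd => le_antisymm (hF hdb) ?_⟩
  rw [hbF]
  exact (wellFounded_lt (α := Cardinal.{u})).min_le (s := S) ⟨d, ⟨hdb.trans hba, hd⟩, rfl⟩

theorem IsHomog.mono {F : A → Cardinal.{u}} {a b : A} (h : IsHomog F a) (hb : b ≠ ⊥)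
    (hba : b ≤ a) : IsHomog F b := fun d hdb hd =>
  (h d (hdb.trans hba) hd).trans (h b hba hb).symm

/-- A set of nonzero pairwise disjoint elements below `a`. -/
def IsCellular (a : A) (S : Set A) : Prop :=
  (∀ x ∈ S, x ≠ ⊥ ∧ x ≤ a) ∧ ∀ x ∈ S, ∀ y ∈ S, x ≠ y → Disjoint x y

/-- The least cardinal which is not the size of a cellular set below `a`. -/
noncomputable def satCard (a : A) : Cardinal.{u} := sInf {l | ¬ ∃ S, IsCellular a S ∧ #S = l}

/-- Cellular sets are closed under subsets, so their sizes form an initial segment. Taking the least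
missing size also records whether the supremum is attained. -/
theorem exists_isCellular_iff (a : A) (l : Cardinal.{u}) :
    (∃ S, IsCellular a S ∧ #S = l) ↔ l < satCard a := by
  have hne : {l | ¬ ∃ S, IsCellular a S ∧ #S = l}.Nonempty := by
    refine ⟨Order.succ #A, ?_⟩
    rintro ⟨S, -, hS⟩
    exact absurd (Order.lt_succ #A) (hS ▸ mk_set_le S).not_gt
  constructor
  · rintro ⟨S, hS, rfl⟩
    by_contra hc
    obtain ⟨T, hT, hTc⟩ := le_mk_iff_exists_subset.1 (not_lt.1 hc)
    exact csInf_mem hne ⟨T, ⟨fun x hx => hS.1 x (hT hx),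
      fun x hx y hy => hS.2 x (hT hx) y (hT hy)⟩, hTc⟩
  · intro h
    by_contra hc
    exact absurd h (csInf_le' (s := {l | ¬ ∃ S, IsCellular a S ∧ #S = l}) hc).not_gt

theorem satCard_mono : Monotone (satCard : A → Cardinal.{u}) := by
  intro a b hab
  by_contra hc
  obtain ⟨S, hS, hSc⟩ := (exists_isCellular_iff a _).2 (not_le.1 hc)
  exact lt_irrefl _ ((exists_isCellular_iff b _).1
    ⟨S, ⟨fun x hx => ⟨(hS.1 x hx).1, (hS.1 x hx).2.trans hab⟩, hS.2⟩, hSc⟩)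

theorem exists_maximal_cellular (P : A → Prop) : ∃ C : Set A, IsCellular ⊤ C ∧ (∀ c ∈ C, P c) ∧
    ∀ x, x ≠ ⊥ → P x → ∃ c ∈ C, x ⊓ c ≠ ⊥ := by
  obtain ⟨C, hC, hmax⟩ := zorn_subset {C : Set A | IsCellular ⊤ C ∧ ∀ c ∈ C, P c} (by
    intro c hc hchain
    refine ⟨⋃₀ c, ⟨⟨?_, ?_⟩, ?_⟩, fun s hs => subset_sUnion_of_mem hs⟩
    · rintro x ⟨s, hs, hx⟩
      exact (hc hs).1.1 x hx
    · rintro x ⟨s, hs, hx⟩ y ⟨t, ht, hy⟩ hne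
      rcases hchain.total hs ht with h | h
      · exact (hc ht).1.2 x (h hx) y hy hne
      · exact (hc hs).1.2 x hx y (h hy) hne
    · rintro x ⟨s, hs, hx⟩
      exact (hc hs).2 x hx)
  refine ⟨C, hC.1, hC.2, fun x hx hPx => ?_⟩
  by_contra hcon
  push Not at hcon
  have hmem : insert x C ∈ {C : Set A | IsCellular ⊤ C ∧ ∀ c ∈ C, P c} := by
    refine ⟨⟨?_, ?_⟩, ?_⟩
    · rintro y (rfl | hy)
      · exact ⟨hx, le_top⟩
      · exact hC.1.1 y hy
    · rintro y (rfl | hy) z (rfl | hz) hne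
      · exact absurd rfl hne
      · exact disjoint_iff.2 (hcon z hz)
      · exact (disjoint_iff.2 (hcon y hy)).symm
      · exact hC.1.2 y hy z hz hne
    · rintro y (rfl | hy)
      · exact hPx
      · exact hC.2 y hy
  have hxC : x ∈ C := hmax hmem (subset_insert x C) (mem_insert x C)
  exact hx (by simpa using hcon x hxC)

/-- Homogeneity for the three invariants used in the count. -/
def Good (c : A) : Prop :=
  IsHomog autCard c ∧ IsHomog satCard c ∧ IsHomog (fun a => #(Iic a)) c

theorem exists_good {a : A} (ha : a ≠ ⊥) : ∃ b ≤ a, b ≠ ⊥ ∧ Good b := by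
  obtain ⟨b, hba, hb, h1⟩ := exists_isHomog (F := autCard) (fun _ _ h => autCard_mono h) ha
  obtain ⟨c, hcb, hc, h2⟩ := exists_isHomog satCard_mono hb
  obtain ⟨d, hdc, hd, h3⟩ := exists_isHomog (F := fun a : A => #(Iic a))
    (fun _ _ h => mk_le_mk_of_subset (Iic_subset_Iic.2 h)) hc
  exact ⟨d, hdc.trans (hcb.trans hba), hd, (h1.mono hd (hdc.trans hcb)), h2.mono hd hdc, h3⟩

variable (A) in
theorem exists_good_partition : ∃ C : Set A, IsCellular ⊤ C ∧ (∀ c ∈ C, Good c) ∧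
    ∀ x : A, x ≠ ⊥ → ∃ c ∈ C, x ⊓ c ≠ ⊥ := by
  obtain ⟨C, h1, h2, h3⟩ := exists_maximal_cellular (Good (A := A))
  refine ⟨C, h1, h2, fun x hx => ?_⟩
  obtain ⟨b, hbx, hb, hg⟩ := exists_good hx
  obtain ⟨c, hc, hbc⟩ := h3 b hb hg
  exact ⟨c, hc, fun h => hbc (le_bot_iff.1 (h ▸ inf_le_inf_right c hbx))⟩

theorem exists_disjoint_sequence {c : A} (hc : c ≠ ⊥)
    (h : ∀ r ≤ c, r ≠ ⊥ → ∃ b b', b ≠ ⊥ ∧ b' ≠ ⊥ ∧ b ≤ r ∧ b' ≤ r ∧ Disjoint b b') :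
    ∃ d : ℕ → A, (∀ n, d n ≤ c ∧ d n ≠ ⊥) ∧ ∀ n m, n ≠ m → Disjoint (d n) (d m) := by
  choose b b' hb hb' hbr hbr' hd using fun r : {r : A // r ≤ c ∧ r ≠ ⊥} => h r.1 r.2.1 r.2.2
  let r : ℕ → {r : A // r ≤ c ∧ r ≠ ⊥} := fun n => Nat.rec ⟨c, le_rfl, hc⟩
    (fun _ r => ⟨b' r, (hbr' r).trans r.2.1, hb' r⟩) n
  have hr : ∀ n, (r (n + 1)).1 = b' (r n) := fun n => rfl
  have hanti : Antitone fun n => (r n).1 := antitone_nat_of_succ_le fun n => hbr' (r n)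
  have hlt : ∀ n m, n < m → Disjoint (b (r n)) (b (r m)) := fun n m hnm =>
    (hd (r n)).mono_right ((hbr (r m)).trans (hanti (Nat.succ_le_of_lt hnm)))
  refine ⟨fun n => b (r n), fun n => ⟨(hbr _).trans (r n).2.1, hb _⟩, fun n m hnm => ?_⟩
  rcases lt_or_gt_of_ne hnm with h | h
  · exact hlt n m h
  · exact (hlt m n h).symm

/-- If c is not rigid, homogeneity makes every nonzero element below it non-rigid, so c contains an
infinite disjoint sequence `d n`. Each `d n` has the cellularity of c and so accommodates a copy of
`E n`; inside each member of the copy lie two disjoint isomorphic elements, whose join has enough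
relative subalgebras. -/
theorem exists_assignment {c : A} (hc : c ≠ ⊥) (hg : Good c) (E : ℕ → Set A)
    (hE : ∀ n, IsCellular c (E n)) : ∃ u : ℕ → A → A,
      (∀ n, ∀ e ∈ E n, u n e ≤ c ∧ autCard c ≤ #(RelSub (u n e))) ∧
      ∀ n, ∀ e ∈ E n, ∀ m, ∀ e' ∈ E m, (n ≠ m ∨ e ≠ e') → Disjoint (u n e) (u m e') := by
  classical
  by_cases h1 : autCard c = 1
  · refine ⟨fun _ _ => ⊥, fun n e _ => ⟨bot_le, ?_⟩, fun n e _ m e' _ _ => disjoint_bot_left⟩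
    rw [h1, Cardinal.one_le_iff_ne_zero, mk_ne_zero_iff]
    exact ⟨⟨{⊥}, by simp [RelSub]⟩⟩
  have hne : ∀ r ≤ c, r ≠ ⊥ → autCard r ≠ 1 := fun r hr hr' => by rwa [hg.1 r hr hr']
  obtain ⟨d, hd, hdd⟩ := exists_disjoint_sequence hc fun r hr hr' => by
    obtain ⟨b, b', h1, h2, h3, h4, h5, -⟩ := exists_disjoint_of_autCard_ne_one (hne r hr hr')
    exact ⟨b, b', h1, h2, h3, h4, h5⟩
  have hw : ∀ s : A, ∃ w ≤ s, s ≤ c → s ≠ ⊥ → autCard c ≤ #(RelSub w) := by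
    intro s
    by_cases hs : s ≤ c ∧ s ≠ ⊥
    · obtain ⟨b, b', h1, h2, h3, h4, h5, ⟨φ⟩⟩ :=
        exists_disjoint_of_autCard_ne_one (hne s hs.1 hs.2)
      refine ⟨b ⊔ b', sup_le h3 h4, fun _ _ => ?_⟩
      rw [← hg.1 b (h3.trans hs.1) h1]
      exact (autCard_le φ).trans (mk_orderIso_le_relSub h5)
    · exact ⟨s, le_rfl, fun h h' => absurd ⟨h, h'⟩ hs⟩
  choose w hws hw using hw
  have hS : ∀ n, ∃ S, IsCellular (d n) S ∧ #S = #(E n) := fun n => by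
    rw [exists_isCellular_iff, hg.2.1 _ (hd n).1 (hd n).2, ← exists_isCellular_iff]
    exact ⟨E n, hE n, rfl⟩
  choose S hS hSE using hS
  have he : ∀ n, Nonempty (E n ≃ S n) := fun n => Cardinal.eq.1 (hSE n).symm
  let e := fun n => (he n).some
  let u : ℕ → A → A := fun n x => if hx : x ∈ E n then w (e n ⟨x, hx⟩) else ⊥
  have hu : ∀ n x (hx : x ∈ E n), u n x = w (e n ⟨x, hx⟩) := fun n x hx => dif_pos hx
  have hSd : ∀ n (s : S n), (s : A) ≤ d n ∧ (s : A) ≠ ⊥ := fun n s =>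
    ⟨((hS n).1 s s.2).2, ((hS n).1 s s.2).1⟩
  refine ⟨u, fun n x hx => ?_, fun n x hx m y hy hne => ?_⟩
  · rw [hu n x hx]
    have h2 := (hSd n (e n ⟨x, hx⟩)).1.trans (hd n).1
    exact ⟨(hws _).trans h2, hw _ h2 (hSd n _).2⟩
  · rw [hu n x hx, hu m y hy]
    refine Disjoint.mono (hws _) (hws _) ?_
    by_cases hnm : n = m
    · subst hnm
      refine (hS n).2 _ (e n ⟨x, hx⟩).2 _ (e n ⟨y, hy⟩).2 fun h => ?_
      have := (e n).injective (Subtype.ext h)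
      exact hne.elim (fun h => h rfl) fun h => h (congrArg Subtype.val this)
    · exact (hdd n m hnm).mono (hSd n _).1 (hSd m _).1

theorem prod_autCard_le_sub {C : Set A} (hC : IsCellular ⊤ C) (hCg : ∀ c ∈ C, Good c)
    (E : ℕ → Set A) (hE : ∀ n, IsCellular ⊤ (E n)) (hEC : ∀ n, ∀ e ∈ E n, ∃ c ∈ C, e ≤ c) :
    prod (fun t : Σ n : ULift.{u} ℕ, E n.down => autCard (t.2 : A)) ≤ BAlg.sub A := by
  choose u hu hud using fun c : C => exists_assignment (hC.1 c c.2).1 (hCg c c.2)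
    (fun n => {e | e ∈ E n ∧ e ≤ c}) fun n => ⟨fun x hx => ⟨((hE n).1 x hx.1).1, hx.2⟩,
      fun x hx y hy => (hE n).2 x hx.1 y hy.1⟩
  choose cc hcc hle using fun t : Σ n : ULift.{u} ℕ, E n.down => hEC t.1.down t.2 t.2.2
  refine le_trans (prod_le_prod _ _ fun t => ?_) (prod_mk_relSub_le
    (fun t : Σ n : ULift.{u} ℕ, E n.down => u ⟨cc t, hcc t⟩ t.1.down t.2) fun t t' hne => ?_)
  · have h1 := hu ⟨cc t, hcc t⟩ t.1.down t.2 ⟨t.2.2, hle t⟩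
    rw [(hCg _ (hcc t)).1 _ (hle t) ((hE _).1 _ t.2.2).1]
    exact h1.2
  · by_cases h : cc t = cc t'
    · have h2 : (⟨cc t, hcc t⟩ : C) = ⟨cc t', hcc t'⟩ := Subtype.ext h
      rw [h2]
      have h3 : (t.2 : A) ≤ cc t' := (hle t).trans h.le
      refine hud _ _ _ ⟨t.2.2, h3⟩ _ _ ⟨t'.2.2, hle t'⟩ ?_
      clear h3
      by_contra hcon
      push Not at hcon
      obtain ⟨⟨n⟩, e, he⟩ := t
      obtain ⟨⟨m⟩, e', he'⟩ := t'
      obtain ⟨h3, h4⟩ := hcon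
      simp only at h3 h4
      subst h3 h4
      exact hne rfl
    · refine Disjoint.mono (hu _ _ _ ⟨t.2.2, hle t⟩).1 (hu _ _ _ ⟨t'.2.2, hle t'⟩).1 ?_
      exact hC.2 _ (hcc t) _ (hcc t') h

end RelAut

/-! ### Counting isomorphisms between ideals -/

namespace RelAut

variable {A : Type u} [BooleanAlgebra A]

/-- Isomorphisms of the ideal `I` onto an ideal, extended by `⊥` outside `I`. -/
def Emb (I : Order.Ideal A) : Set (A → A) :=
  {F | F ⊥ = ⊥ ∧ (∀ x ∈ I, ∀ y ∈ I, F (x ⊔ y) = F x ⊔ F y) ∧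
    (∀ x ∈ I, ∀ y ∈ I, F (x ⊓ y) = F x ⊓ F y) ∧ (∀ x ∈ I, F x = ⊥ → x = ⊥) ∧
    (∀ x ∈ I, ∀ w ≤ F x, ∃ z ∈ I, F z = w) ∧ ∀ x ∉ I, F x = ⊥}

variable {I : Order.Ideal A} {F F' : A → A}

theorem Emb.le_iff (hF : F ∈ Emb I) {x y : A} (hx : x ∈ I) (hy : y ∈ I) : F x ≤ F y ↔ x ≤ y := by
  obtain ⟨hbot, hsup, hinf, hker, -, -⟩ := hF
  constructor
  · intro h
    have hxy : x \ y ∈ I := I.lower sdiff_le hx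
    have hxy' : x ⊓ y ∈ I := I.lower inf_le_left hx
    rw [← sdiff_eq_bot_iff]
    refine hker _ hxy ?_
    have h1 : F (x \ y) ⊓ F y = ⊥ := by
      rw [← hinf _ hxy _ hy, disjoint_sdiff_self_left.eq_bot, hbot]
    have h2 : F (x \ y) ≤ F x := by
      have := hsup _ hxy' _ hxy
      rw [sup_inf_sdiff] at this
      rw [this]
      exact le_sup_right
    rwa [inf_eq_left.2 (h2.trans h)] at h1
  · intro h
    have := hinf _ hx _ hy
    rw [inf_eq_left.2 h] at this
    rw [this]
    exact inf_le_right

theorem Emb.exists_orderIso (hF : F ∈ Emb I) {e a : A} (he : e ∈ I) (hea : F e = a) :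
    ∃ φ : Iic e ≃o Iic a, ∀ x, (φ x : A) = F x := by
  subst hea
  have hI : ∀ x : Iic e, (x : A) ∈ I := fun x => I.lower x.2 he
  let g : Iic e → Iic (F e) := fun x => ⟨F x, (Emb.le_iff hF (hI x) he).2 x.2⟩
  have hg : ∀ x y, g x ≤ g y ↔ x ≤ y := fun x y => Emb.le_iff hF (hI x) (hI y)
  have hbij : Function.Bijective g := by
    refine ⟨fun x y h => le_antisymm ((hg x y).1 h.le) ((hg y x).1 h.ge), fun w => ?_⟩
    obtain ⟨z, hz, hzw⟩ := hF.2.2.2.2.1 e he w w.2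
    exact ⟨⟨z, (Emb.le_iff hF hz he).1 (hzw.trans_le w.2)⟩, Subtype.ext hzw⟩
  exact ⟨⟨Equiv.ofBijective g hbij, fun {x y} => hg x y⟩, fun x => rfl⟩

/-- The range is downward closed, so a nonzero difference F x \ F' x pulls back to some z ≤ x, which
meets a member of E, where the two maps agree. -/
theorem Emb.ext_of_eqOn (hF : F ∈ Emb I) (hF' : F' ∈ Emb I) {E : Set A}
    (hE : ∀ x ∈ I, x ≠ ⊥ → ∃ e ∈ E, x ⊓ e ≠ ⊥) (h : ∀ e ∈ E, ∀ x ≤ e, F x = F' x) : F = F' := by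
  have key : ∀ F F' : A → A, F ∈ Emb I → F' ∈ Emb I → (∀ e ∈ E, ∀ x ≤ e, F x = F' x) →
      ∀ x ∈ I, F x ≤ F' x := by
    intro F F' hF hF' h x hx
    by_contra hc
    obtain ⟨z, hz, hzw⟩ := hF.2.2.2.2.1 x hx (F x \ F' x) sdiff_le
    have hz0 : z ≠ ⊥ := by
      rintro rfl
      rw [hF.1] at hzw
      exact hc (sdiff_eq_bot_iff.1 hzw.symm)
    have hzx : z ≤ x := (Emb.le_iff hF hz hx).1 (hzw.trans_le sdiff_le)
    obtain ⟨e, he, hze⟩ := hE z hz hz0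
    have hy : z ⊓ e ∈ I := I.lower inf_le_left hz
    refine hze (hF.2.2.2.1 _ hy ?_)
    have h1 : F (z ⊓ e) ≤ F x \ F' x := hzw ▸ (Emb.le_iff hF hy hz).2 inf_le_left
    have h2 : F (z ⊓ e) ≤ F' x := by
      rw [h e he _ inf_le_right]
      exact (Emb.le_iff hF' hy hx).2 (inf_le_left.trans hzx)
    exact le_bot_iff.1 (disjoint_sdiff_self_left h1 h2)
  funext x
  by_cases hx : x ∈ I
  · exact le_antisymm (key F F' hF hF' h x hx)
      (key F' F hF' hF (fun e he x hxe => (h e he x hxe).symm) x hx)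
  · rw [hF.2.2.2.2.2 x hx, hF'.2.2.2.2.2 x hx]

/-- The families of nonzero pairwise disjoint elements indexed by `E`. -/
def DisjointFamily (E : Set A) : Set (E → A) :=
  {d | (∀ e, d e ≠ ⊥) ∧ ∀ e e', e ≠ e' → Disjoint (d e) (d e')}

/-- A family d is coded by the pairs (e, c) for which d e meets c, and by the pieces d e ⊓ c. For a
fixed support, realized by `d₀`, size homogeneity replaces the bound `#(Iic c)` on each piece by
`#(Iic (d₀ e ⊓ c))`. These elements are disjoint, so the product is at most the number of ideals. -/
theorem mk_disjointFamily_le [Infinite A] {C E : Set A} (hC : IsCellular ⊤ C)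
    (hCg : ∀ c ∈ C, Good c) (hCmax : ∀ x : A, x ≠ ⊥ → ∃ c ∈ C, x ⊓ c ≠ ⊥)
    (hE : IsCellular ⊤ E) : #(DisjointFamily E) ≤ #(Order.Ideal A) := by
  have hω : ℵ₀ ≤ #(Order.Ideal A) :=
    (aleph0_le_mk A).trans (BooleanIdeals.mk_le_mk_ideal A)
  have h2ω : 2 ^ ℵ₀ ≤ #(Order.Ideal A) := by
    rw [← BooleanIdeals.mk_ideal_power_aleph0 A]
    exact power_le_power_right ((natCast_lt_aleph0 (n := 2)).le.trans hω)
  have hcell : ∀ S : Set A, IsCellular ⊤ S → 2 ^ #S ≤ #(Order.Ideal A) := fun S hS =>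
    BooleanIdeals.two_power_le_mk_ideal (fun x hx => (hS.1 x hx).1) hS.2
  have h2 : #(Set (E × C)) ≤ #(Order.Ideal A) := by
    rw [mk_set, mk_prod, lift_id, lift_id]
    refine (power_le_power_left two_ne_zero (mul_le_max _ _)).trans ?_
    rcases max_choice (max #E #C) ℵ₀ with h | h <;> rw [h]
    · rcases max_choice #E #C with h | h <;> rw [h]
      exacts [hcell E hE, hcell C hC]
    · exact h2ω
  let supp : DisjointFamily E → Set (E × C) := fun d => {p | d.1 p.1 ⊓ p.2 ≠ ⊥}
  have h3 := mk_le_mk_mul_of_mk_preimage_le (c := #(Order.Ideal A)) supp fun R => ?_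
  · refine h3.trans ((mul_le_mul' h2 le_rfl).trans (mul_eq_self hω).le)
  by_cases hR : ∃ d, supp d = R
  swap
  · have : supp ⁻¹' {R} = ∅ := eq_empty_of_forall_notMem fun d hd => hR ⟨d, hd⟩
    rw [this]
    simp
  obtain ⟨d₀, rfl⟩ := hR
  have h4 : #(supp ⁻¹' {supp d₀}) ≤ #(∀ r : supp d₀, Iic (r.1.2 : A)) := by
    refine mk_le_of_injective (f := fun d r => ⟨d.1.1 r.1.1 ⊓ r.1.2, inf_le_right⟩) ?_
    intro d d' e
    have key : ∀ p : E × C, d.1.1 p.1 ⊓ p.2 = d'.1.1 p.1 ⊓ p.2 := by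
      intro p
      by_cases hp : p ∈ supp d₀
      · have := congrArg Subtype.val (congrFun e ⟨p, hp⟩)
        exact this
      · have h5 : p ∉ supp d.1 := by rwa [show supp d.1 = supp d₀ from d.2]
        have h6 : p ∉ supp d'.1 := by rwa [show supp d'.1 = supp d₀ from d'.2]
        exact (not_not.1 h5).trans (not_not.1 h6).symm
    have hle : ∀ x y : A, (∀ c ∈ C, x ⊓ c = y ⊓ c) → x ≤ y := by
      intro x y hxy
      rw [← sdiff_eq_bot_iff]
      by_contra hne
      obtain ⟨c, hc, hxc⟩ := hCmax _ hne
      refine hxc (le_bot_iff.1 ?_)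
      have h7 : x \ y ⊓ c ≤ y := by
        refine le_trans ?_ (inf_le_left (a := y) (b := c))
        rw [← hxy c hc]
        exact inf_le_inf_right c sdiff_le
      exact disjoint_sdiff_self_left inf_le_left h7
    refine Subtype.ext (Subtype.ext (funext fun x => ?_))
    exact le_antisymm (hle _ _ fun c hc => key (x, ⟨c, hc⟩))
      (hle _ _ fun c hc => (key (x, ⟨c, hc⟩)).symm)
  refine h4.trans ?_
  rw [mk_pi]
  refine le_trans (prod_le_prod _ _ fun r => ?_) (BooleanIdeals.prod_mk_Iic_le_mk_ideal
    (fun r : supp d₀ => d₀.1 r.1.1 ⊓ (r.1.2 : A)) fun r r' hne => ?_)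
  · exact ((hCg _ r.1.2.2).2.2 _ inf_le_right r.2).ge
  · by_cases h : r.1.1 = r'.1.1
    · refine Disjoint.mono inf_le_right inf_le_right (hC.2 _ r.1.2.2 _ r'.1.2.2 fun h' => hne ?_)
      exact Subtype.ext (Prod.ext h (Subtype.ext h'))
    · exact Disjoint.mono inf_le_left inf_le_left (d₀.2.2 _ _ h)

theorem mk_emb_le [Infinite A] {C E : Set A} (hC : IsCellular ⊤ C)
    (hCg : ∀ c ∈ C, Good c) (hCmax : ∀ x : A, x ≠ ⊥ → ∃ c ∈ C, x ⊓ c ≠ ⊥)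
    (hE : IsCellular ⊤ E) (hEI : ∀ e ∈ E, e ∈ I)
    (hEmax : ∀ x ∈ I, x ≠ ⊥ → ∃ e ∈ E, x ⊓ e ≠ ⊥) :
    #(Emb I) ≤ #(Order.Ideal A) * prod fun e : E => autCard (e : A) := by
  refine le_trans ?_ (mul_le_mul' (mk_disjointFamily_le hC hCg hCmax hE) le_rfl)
  have hd : ∀ F : Emb I, (fun e : E => F.1 e) ∈ DisjointFamily E := by
    rintro ⟨F, hF⟩
    refine ⟨fun e he => (hE.1 e e.2).1 (hF.2.2.2.1 _ (hEI e e.2) he), fun e e' hne => ?_⟩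
    have h1 : (e : A) ⊓ e' = ⊥ := (hE.2 e e.2 e' e'.2 fun h => hne (Subtype.ext h)).eq_bot
    change Disjoint (F e) (F e')
    rw [disjoint_iff, ← hF.2.2.1 _ (hEI e e.2) _ (hEI e' e'.2), h1, hF.1]
  refine mk_le_mk_mul_of_mk_preimage_le (fun F : Emb I => (⟨_, hd F⟩ : DisjointFamily E))
    fun d => ?_
  have hd' : ∀ F : (fun F : Emb I => (⟨_, hd F⟩ : DisjointFamily E)) ⁻¹' {d}, ∀ e : E,
      F.1.1 e = d.1 e := fun F e => congrFun (congrArg Subtype.val F.2) e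
  choose φ hφ using fun F : (fun F : Emb I => (⟨_, hd F⟩ : DisjointFamily E)) ⁻¹' {d} =>
    fun e : E => Emb.exists_orderIso F.1.2 (hEI e e.2) (hd' F e)
  have h1 : #((fun F : Emb I => (⟨_, hd F⟩ : DisjointFamily E)) ⁻¹' {d}) ≤
      #(∀ e : E, Iic (e : A) ≃o Iic (d.1 e)) := by
    refine mk_le_of_injective (f := φ) fun F F' h => Subtype.ext (Subtype.ext ?_)
    refine Emb.ext_of_eqOn F.1.2 F'.1.2 hEmax fun e he x hx => ?_
    rw [← hφ F ⟨e, he⟩ ⟨x, hx⟩, ← hφ F' ⟨e, he⟩ ⟨x, hx⟩, h]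
  rw [mk_pi] at h1
  exact h1.trans (prod_le_prod _ _ fun e => mk_orderIso_le _ _)

/-- A sequence of maps is coded by two sequences of ideals and a family of automorphisms of the
relative algebras `Iic e`. The ideals are counted by i ^ ℵ₀ = i, the automorphisms by
`prod_autCard_le_sub`. -/
theorem mk_sequence_emb_le [Infinite A] :
    #(ULift.{u} ℕ → Σ I : Order.Ideal A, Emb I) ≤ BAlg.sub A := by
  obtain ⟨C, hC, hCg, hCmax⟩ := exists_good_partition A
  have hE : ∀ I : Order.Ideal A, ∃ E : Set A, IsCellular ⊤ E ∧
      (∀ e ∈ E, e ∈ I ∧ ∃ c ∈ C, e ≤ c) ∧ ∀ x ∈ I, x ≠ ⊥ → ∃ e ∈ E, x ⊓ e ≠ ⊥ := by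
    intro I
    obtain ⟨E, h1, h2, h3⟩ := exists_maximal_cellular fun e => e ∈ I ∧ ∃ c ∈ C, e ≤ c
    refine ⟨E, h1, h2, fun x hx hx0 => ?_⟩
    obtain ⟨c, hc, hxc⟩ := hCmax x hx0
    obtain ⟨e, he, hxe⟩ := h3 (x ⊓ c) hxc ⟨I.lower inf_le_left hx, c, hc, inf_le_right⟩
    exact ⟨e, he, fun h => hxe (le_bot_iff.1 (h ▸ inf_le_inf_right e inf_le_left))⟩
  choose E hEc hEI hEmax using hE
  let Q : Order.Ideal A → Type u := fun I => ∀ e : E I, Iic (e : A) ≃o Iic (e : A)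
  have hQ : ∀ I, #(Emb I) ≤ #(Order.Ideal A × Q I) := by
    intro I
    rw [mk_prod, lift_id, lift_id, mk_pi]
    exact mk_emb_le hC hCg hCmax (hEc I) (fun e he => (hEI I e he).1) (hEmax I)
  let g : ∀ I, Emb I ↪ Order.Ideal A × Q I := fun I => Classical.choice (hQ I)
  have h1 : #(Σ I : Order.Ideal A, Emb I) ≤ #(Order.Ideal A × Σ I, Q I) := by
    refine mk_le_of_injective (f := fun s => ((g s.1 s.2).1, ⟨s.1, (g s.1 s.2).2⟩)) ?_
    rintro ⟨I, F⟩ ⟨I', F'⟩ e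
    obtain ⟨e1, e2⟩ := Prod.ext_iff.1 e
    obtain rfl : I = I' := congrArg Sigma.fst e2
    have e3 := eq_of_heq (Sigma.ext_iff.1 e2).2
    exact congrArg _ ((g I).injective (Prod.ext e1 e3))
  have h2 : #(ULift.{u} ℕ → Σ I, Q I) ≤ #(Σ J : ULift.{u} ℕ → Order.Ideal A, ∀ n, Q (J n)) :=
    mk_le_of_injective (f := fun f => ⟨fun n => (f n).1, fun n => (f n).2⟩)
      (Function.LeftInverse.injective (g := fun p n => ⟨p.1 n, p.2 n⟩) fun _ => rfl)
  have h3 : ∀ J : ULift.{u} ℕ → Order.Ideal A, #(∀ n, Q (J n)) ≤ BAlg.sub A := by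
    intro J
    have h4 := prod_autCard_le_sub hC hCg (fun n => E (J ⟨n⟩)) (fun n => hEc _)
      fun n e he => (hEI _ e he).2
    have h5 := mk_congr (Equiv.piCurry fun (n : ULift.{u} ℕ) (e : E (J n)) =>
      Iic (e : A) ≃o Iic (e : A))
    rw [mk_pi] at h5
    exact h5.symm.le.trans h4
  have hI := BooleanIdeals.mk_ideal_power_aleph0 A
  have hIs := BooleanIdeals.mk_ideal_le_sub A
  have hω : ℵ₀ ≤ BAlg.sub A := (aleph0_le_mk A).trans ((BooleanIdeals.mk_le_mk_ideal A).trans hIs)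
  have hJ : #(ULift.{u} ℕ → Order.Ideal A) ≤ BAlg.sub A := by
    rw [← power_def]
    simpa [hI] using hIs
  have h6 : #(ULift.{u} ℕ → Σ I, Q I) ≤ BAlg.sub A := by
    refine h2.trans ?_
    rw [mk_sigma]
    refine (sum_le_sum _ (fun _ => BAlg.sub A) h3).trans ?_
    rw [sum_const']
    exact mul_le_of_le hω hJ le_rfl
  rw [← power_def] at h6 hJ ⊢
  refine (power_le_power_right h1).trans ?_
  rw [mk_prod, lift_id, lift_id, mul_power]
  exact mul_le_of_le hω hJ h6

variable (A) in
theorem mk_aut6_le : BAlg.aut6 A ≤ #(Σ I : Order.Ideal A, Emb I) := by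
  classical
  have hex : ∀ f : BAlg.Aut6 A, ∃ I : Order.Ideal A, ∃ F ∈ Emb I,
      ∀ x u, u ∈ f.1 x ↔ x ∈ I ∧ F x = u := by
    rintro ⟨f, ⟨I, J, hf⟩, hker⟩
    let F : A → A := fun x => if h : (f x).Dom then (f x).get h else ⊥
    have hdom : ∀ x, (f x).Dom ↔ x ∈ I := fun x => by
      have : x ∈ f.Dom ↔ x ∈ (I : Set A) := by rw [hf.dom_eq]
      exact this
    have hF : ∀ x u, u ∈ f x ↔ x ∈ I ∧ F x = u := by
      intro x u
      rw [← hdom]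
      constructor
      · rintro ⟨h, rfl⟩
        exact ⟨h, dif_pos h⟩
      · rintro ⟨h, rfl⟩
        exact ⟨h, (dif_pos h).symm⟩
    have hFI : ∀ x ∈ I, F x ∈ f x := fun x hx => (hF x _).2 ⟨hx, rfl⟩
    have hJ : ∀ u, u ∈ J ↔ ∃ x ∈ I, F x = u := by
      intro u
      have : u ∈ f.ran ↔ u ∈ (J : Set A) := by rw [hf.ran_eq]
      exact this.symm.trans (exists_congr fun x => hF x u)
    refine ⟨I, F, ⟨((hF _ _).1 hf.map_bot).2, fun x hx y hy => ?_, fun x hx y hy => ?_,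
      fun x hx h => ?_, fun x hx w hw => ?_, fun x hx => ?_⟩, hF⟩
    · exact ((hF _ _).1 (hf.map_sup x y _ _ (hFI x hx) (hFI y hy))).2
    · exact ((hF _ _).1 (hf.map_inf x y _ _ (hFI x hx) (hFI y hy))).2
    · exact (hker x ((hdom x).2 hx)).1 (h ▸ hFI x hx)
    -- The range is an ideal, which gives the downward surjectivity required in `Emb`.
    · exact (hJ w).1 (J.lower hw ((hJ _).2 ⟨x, hx, rfl⟩))
    · exact dif_neg fun h => hx ((hdom x).1 h)
  choose I F hF hfF using hex
  refine mk_le_of_injective (f := fun f => ⟨I f, F f, hF f⟩) ?_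
  intro f f' e
  have key : ∀ s s' : (Σ I : Order.Ideal A, Emb I), s = s' → ∀ x u,
      (x ∈ s.1 ∧ s.2.1 x = u) ↔ (x ∈ s'.1 ∧ s'.2.1 x = u) := by
    rintro s _ rfl x u
    rfl
  exact Subtype.ext (PFun.ext fun x u => (hfF f x u).trans ((key _ _ e x u).trans
    (hfF f' x u).symm))

variable (A) in
theorem aut6_power_le_sub [Infinite A] : BAlg.aut6 A ^ ℵ₀ ≤ BAlg.sub A := by
  refine (power_le_power_right (mk_aut6_le A)).trans ?_
  have := mk_sequence_emb_le (A := A)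
  rw [← power_def] at this
  simpa using this

variable (A) in
theorem aut_le_aut6 : BAlg.aut A ≤ BAlg.aut6 A := by
  have hmem : ∀ f : BAlg.Aut A, (fun x => Part.some (f.1 x) : A →. A) ∈ BAlg.Aut6 A := by
    rintro ⟨f, hf⟩
    refine ⟨⟨⊤, ⊤, ?_, ?_, ?_, ?_, ?_⟩, ?_⟩
    · exact Set.ext fun x => iff_of_true trivial trivial
    · refine Set.ext fun u => iff_of_true ?_ trivial
      obtain ⟨x, rfl⟩ := hf.2 u
      exact ⟨x, Part.mem_some _⟩
    · simp
    · intro x y u v hu hv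
      rw [Part.mem_some_iff] at hu hv ⊢
      rw [hu, hv, map_sup]
    · intro x y u v hu hv
      rw [Part.mem_some_iff] at hu hv ⊢
      rw [hu, hv, map_inf]
    · intro x _
      rw [Part.mem_some_iff]
      refine ⟨fun h => hf.1 (h.symm.trans (map_bot f).symm), ?_⟩
      rintro rfl
      exact (map_bot f).symm
  refine mk_le_of_injective (f := fun f => ⟨_, hmem f⟩) fun f f' e => ?_
  refine Subtype.ext (DFunLike.ext _ _ fun x => ?_)
  exact Part.some_injective (congrFun (congrArg Subtype.val e) x)

end RelAut

theorem mainTheorem6 (A : Type*) [BooleanAlgebra A] [Infinite A] :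
    BAlg.aut A ^ ℵ₀ ≤ BAlg.sub A ∧
    BAlg.aut3 A ^ ℵ₀ ≤ BAlg.sub A ∧
    BAlg.aut4 A ^ ℵ₀ ≤ BAlg.sub A ∧
    BAlg.aut5 A ^ ℵ₀ ≤ BAlg.sub A ∧
    BAlg.aut6 A ^ ℵ₀ ≤ BAlg.sub A ∧
    2 ^ ℵ₀ ≤ BAlg.sub A := by
  have key : ∀ c, c ≤ BAlg.aut6 A → c ^ ℵ₀ ≤ BAlg.sub A := fun c hc =>
    (power_le_power_right hc).trans (RelAut.aut6_power_le_sub A)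
  refine ⟨key _ (RelAut.aut_le_aut6 A), key _ (mk_le_mk_of_subset ?_),
    key _ (mk_le_mk_of_subset ?_), key _ (mk_le_mk_of_subset ?_), key _ le_rfl, ?_⟩
  · rintro f ⟨⟨I, -, h⟩, hk⟩
    exact ⟨⟨I, I, h⟩, hk⟩
  · rintro f ⟨⟨I, h⟩, hk⟩
    exact ⟨⟨I, I, h⟩, hk⟩
  · rintro f ⟨⟨I, J, -, -, h⟩, hk⟩
    exact ⟨⟨I, J, h⟩, hk⟩
  · refine le_trans ?_ (BooleanIdeals.mk_ideal_le_sub A)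
    rw [← BooleanIdeals.mk_ideal_power_aleph0 A]
    exact power_le_power_right ((natCast_lt_aleph0 (n := 2)).le.trans
      ((aleph0_le_mk A).trans (BooleanIdeals.mk_le_mk_ideal A)))
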